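/- Consider the scheduling problem $P \mid r_j,\ or\text{-}prec,\ p_j = 1 \mid C_{\max}$. An instance consists of a set $[n] = \{1,\dots,n\}$ of jobs, a number $m$ of identical parallel machines, for every job $j$ a release date $r_j \in \mathbb{Z}_{\ge 0}$ and the processing time $p_j = 1$, and a directed graph $G = ([n], E)$, given by a list of its arcs; the set of predecessors of $j$ is $\mathcal{P}(j) = \{ i : (i,j) \in E\}$. All numbers are encoded in binary. A (non-preemptive) schedule assigns to every job $j$ a machine and a real start time $S_j$; its completion time is $C_j = S_j + p_j$. The schedule is feasible if each machine processes at most one job at a time, $S_j \ge r_j$ for all $j$, and every job $j$ with $\mathcal{P}(j) \neq \emptyset$ satisfies $S_j \ge \min\{C_i : i \in \mathcal{P}(j)\}$ (at least one predecessor is completed before $j$ starts). The makespan is $C_{\max} = \max_{j} C_j$ (zero if $n = 0$). Then $P \mid r_j,\ or\text{-}prec,\ p_j = 1 \mid C_{\max}$ can be solved to optimality in polynomial time: there is an algorithm (a random access machine with logarithmic cost) whose running time is bounded by a polynomial in the bit length of the instance and which, for every instance, either returns a feasible schedule of minimum makespan among all feasible schedules, or correctly reports that the instance has no feasible schedule.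 -/

import Mathlib

/-! ## Random access machines with logarithmic cost

A fixed, finite program works on registers, on memory banks that are addressed indirectly through
registers, and on a write-only output. All stored numbers are natural numbers of unbounded size, and
every instruction is charged the total bit length of the numbers it handles (contents and
addresses), so this model is polynomially related to Turing machines. -/

namespace RAM

/-- The length of the binary representation of `x`, plus one (for a separator). -/
def len (x : ℕ) : ℕ := Nat.size x + 1

/-- The bit length of a list of natural numbers, each written in binary. -/
def bitSize (l : List ℕ) : ℕ := (l.map len).sum

/-- Programs. The arguments are register names and bank names, which are constants of the program
(and the literal `c` in `const r c`). -/
inductive Prog : Type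
  /-- do nothing -/
  | skip : Prog
  /-- `R r := c` -/
  | const (r c : ℕ) : Prog
  /-- `R r := R s + R t` -/
  | add (r s t : ℕ) : Prog
  /-- `R r := max (R s - R t) 0` -/
  | sub (r s t : ℕ) : Prog
  /-- `R r := M k [R s]` -/
  | load (r k s : ℕ) : Prog
  /-- `M k [R s] := R r` -/
  | store (k s r : ℕ) : Prog
  /-- append `R r` to the output -/
  | write (r : ℕ) : Prog
  /-- first `P`, then `Q` -/
  | seq (P Q : Prog) : Prog
  /-- if `R r ≠ 0` then `P` else `Q` -/
  | cond (r : ℕ) (P Q : Prog) : Prog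
  /-- while `R r ≠ 0` do `P` -/
  | loop (r : ℕ) (P : Prog) : Prog

/-- A state of the machine. -/
structure State where
  /-- the contents of the registers -/
  reg : ℕ → ℕ
  /-- `mem k a` is the content of the cell with address `a` in bank `k` -/
  mem : ℕ → ℕ → ℕ
  /-- the output written so far -/
  out : List ℕ

/-- The state `σ` after writing `v` into the register `r`. -/
def State.setReg (σ : State) (r v : ℕ) : State :=
  { σ with reg := Function.update σ.reg r v }

/-- The state `σ` after writing `v` into the cell with address `a` of bank `k`. -/
def State.setMem (σ : State) (k a v : ℕ) : State :=
  { σ with mem := Function.update σ.mem k (Function.update (σ.mem k) a v) }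

/-- The initial state on the input `l`: the input stands in bank `0` from address `0` on, its number
of entries stands in register `0`, and everything else is zero or empty. -/
def State.init (l : List ℕ) : State where
  reg := fun r => if r = 0 then l.length else 0
  mem := fun k a => if k = 0 then l.getD a 0 else 0
  out := []

/-- `Exec P σ τ t`: started in the state `σ`, the program `P` halts in the state `τ`, and the total
logarithmic cost of the executed instructions is `t`. -/
inductive Exec : Prog → State → State → ℕ → Prop
  | skip (σ : State) : Exec .skip σ σ 1
  | const (σ : State) (r c : ℕ) : Exec (.const r c) σ (σ.setReg r c) (len c)
  | add (σ : State) (r s t : ℕ) :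
      Exec (.add r s t) σ (σ.setReg r (σ.reg s + σ.reg t)) (len (σ.reg s) + len (σ.reg t))
  | sub (σ : State) (r s t : ℕ) :
      Exec (.sub r s t) σ (σ.setReg r (σ.reg s - σ.reg t)) (len (σ.reg s) + len (σ.reg t))
  | load (σ : State) (r k s : ℕ) :
      Exec (.load r k s) σ (σ.setReg r (σ.mem k (σ.reg s)))
        (len (σ.reg s) + len (σ.mem k (σ.reg s)))
  | store (σ : State) (k s r : ℕ) :
      Exec (.store k s r) σ (σ.setMem k (σ.reg s) (σ.reg r)) (len (σ.reg s) + len (σ.reg r))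
  | write (σ : State) (r : ℕ) :
      Exec (.write r) σ { σ with out := σ.out ++ [σ.reg r] } (len (σ.reg r))
  | seq {P Q : Prog} {σ τ υ : State} {t u : ℕ} :
      Exec P σ τ t → Exec Q τ υ u → Exec (.seq P Q) σ υ (t + u)
  | cond_true {r : ℕ} {P Q : Prog} {σ τ : State} {t : ℕ} :
      σ.reg r ≠ 0 → Exec P σ τ t → Exec (.cond r P Q) σ τ (len (σ.reg r) + t)
  | cond_false {r : ℕ} {P Q : Prog} {σ τ : State} {t : ℕ} :
      σ.reg r = 0 → Exec Q σ τ t → Exec (.cond r P Q) σ τ (len (σ.reg r) + t)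
  | loop_stop {r : ℕ} {P : Prog} {σ : State} :
      σ.reg r = 0 → Exec (.loop r P) σ σ (len (σ.reg r))
  | loop_step {r : ℕ} {P : Prog} {σ τ υ : State} {t u : ℕ} :
      σ.reg r ≠ 0 → Exec P σ τ t → Exec (.loop r P) τ υ u →
        Exec (.loop r P) σ υ (len (σ.reg r) + t + u)

/-- The search problem "given `x ∈ D`, written as `enc x`, output some `l` with `sol x l`" is
solvable in polynomial time: one program halts on every such input with a correct output, at a cost
that is bounded by a polynomial in the bit length of the input. -/
def PolyTimeSolvable {α : Type} (D : Set α) (enc : α → List ℕ) (sol : α → List ℕ → Prop) : Prop :=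
  ∃ (P : Prog) (q : Polynomial ℕ), ∀ x ∈ D, ∃ (τ : State) (t : ℕ),
    Exec P (State.init (enc x)) τ t ∧ t ≤ q.eval (bitSize (enc x)) ∧ sol x τ.out

end RAM

/-! ## Scheduling with release dates and OR-precedence constraints on identical machines -/

namespace OrSched

/-- An instance of `P | r_j, or-prec | C_max`. Jobs are the elements of `Fin n`; the precedence graph
is an arbitrary directed graph on the jobs, given by a list of its arcs. -/
structure Instance where
  /-- number of jobs -/
  n : ℕ
  /-- number of machines -/
  m : ℕ
  /-- release dates -/
  release : Fin n → ℕ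
  /-- processing times -/
  proc : Fin n → ℕ
  /-- arcs `(i, j)` of the precedence graph, from the predecessor `i` to the job `j` -/
  arcs : List (Fin n × Fin n)

namespace Instance

variable (I : Instance)

/-- The set of predecessors of a job. -/
def pred (j : Fin I.n) : Set (Fin I.n) := {i | (i, j) ∈ I.arcs}

/-- A (non-preemptive) assignment of jobs to machines and to arbitrary real start times. -/
structure Schedule where
  /-- the start time of a job -/
  start : Fin I.n → ℝ
  /-- the machine on which a job is processed -/
  machine : Fin I.n → Fin I.m

variable {I}

/-- The completion time of a job. -/
def Schedule.completion (S : I.Schedule) (j : Fin I.n) : ℝ := S.start j + I.proc j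

/-- Feasibility of a schedule. -/
structure Schedule.Feasible (S : I.Schedule) : Prop where
  /-- each machine processes only one job at a time -/
  disjoint : ∀ i j, i ≠ j → S.machine i = S.machine j →
    S.completion i ≤ S.start j ∨ S.completion j ≤ S.start i
  /-- no job starts before its release date -/
  release_le : ∀ j, (I.release j : ℝ) ≤ S.start j
  /-- a job that has predecessors starts after the completion of at least one of them -/
  or_prec : ∀ j, (I.pred j).Nonempty → ∃ i ∈ I.pred j, S.completion i ≤ S.start j

/-- The makespan, i.e. the maximum of the completion times (zero if there are no jobs). -/
noncomputable def Schedule.makespan (S : I.Schedule) : ℝ := ⨆ j, S.completion j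

/-- A schedule is optimal if it is feasible and no feasible schedule has a smaller makespan. -/
def Schedule.Optimal (S : I.Schedule) : Prop :=
  S.Feasible ∧ ∀ S' : I.Schedule, S'.Feasible → S.makespan ≤ S'.makespan

variable (I)

/-- The input of the problem as a list of numbers: the numbers of jobs, machines and arcs, the
release dates, the processing times, and the arcs. -/
def encode : List ℕ :=
  [I.n, I.m, I.arcs.length] ++ List.ofFn I.release ++ List.ofFn I.proc ++
    I.arcs.flatMap fun a => [a.1.val, a.2.val]

/-- Correct outputs: an optimal schedule, written as `1` followed by all start times and then all
machines, or the single number `0` if there is no feasible schedule. -/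
def IsSolution (l : List ℕ) : Prop :=
  (∃ (s : Fin I.n → ℕ) (μ : Fin I.n → Fin I.m),
      l = 1 :: (List.ofFn s ++ List.ofFn fun j => (μ j).val) ∧
      Schedule.Optimal (I := I) ⟨fun j => (s j : ℝ), μ⟩) ∨
    ((¬ ∃ S : I.Schedule, S.Feasible) ∧ l = [0])

end Instance

end OrSched

/-!
# Unit jobs with release dates and OR-precedence constraints

**Why the problem is easy.** Dijkstra's algorithm computes for every job `j` the earliest start time
`key j` on unlimitedly many machines: `key j` is the release date of `j`, or, if `j` has
predecessors, the maximum of the release date and `key p + 1` for a predecessor `p` of minimal key,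
which becomes the parent of `j`. If some job is never reached, then the unreached jobs wait for each
other and there is no feasible schedule (`Data.Stuck.not_feas`). Otherwise `key j` is a lower bound
for the start of `j` in every feasible schedule (`Data.Reach.key_le_start`), and it suffices to
respect the keys and to start every job after its parent. The parents form a forest in which keys
increase from parent to child.

Read backwards from the end of the schedule, this is an in-forest of unit jobs with deadlines: if
`M` is the integral part of the makespan of a feasible schedule, then in this schedule `j` would
occupy one of the slots `0, …, M - 1 - key j`, counted from the end, so at most `m * (d + 1)` jobs
have a deadline `M - 1 - key j` of at most `d` (`Data.Feas.card_le`). Under this counting condition,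
placing the jobs in the order of nonincreasing keys, each into the first slot that is not full and
lies behind the slots of all its children, meets all deadlines (`greedy_le_deadline`). The reason:
if `i` were late and `s` were the last slot up to its deadline that is not full, then `i` and all jobs
placed behind `s` would have a descendant in slot `s`; since the ancestors of a single job have
distinct deadlines, there would be too few of them to fill the slots after `s`. The placement does not depend
on `M`; so letting the schedule end at the least time that respects all keys makes it optimal
(`Data.Reach.optimal`). Slots are counted from the end, and none is skipped needlessly, so at most
`n` of them are used even if the release dates are huge.

**Running time.** The algorithm is written in a small language with expressions and `for` loops
(`Cmd`), whose semantics is a function on states and which is compiled to the machine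
(`Cmd.comp_spec`). The loops are bounded by the numbers of jobs and arcs, so the number of unit
steps is polynomial. A unit step lengthens the longest stored number by at most one bit, so the
logarithmic cost is polynomial, too (`Runs`).
-/

namespace RAM

/-! ### Unit steps and logarithmic cost -/

theorem len_pos (x : ℕ) : 1 ≤ len x := by simp [len]

theorem len_mono {x y : ℕ} (h : x ≤ y) : len x ≤ len y :=
  Nat.add_le_add_right (Nat.size_le_size h) 1

theorem len_add_le {x y B : ℕ} (hx : len x ≤ B) (hy : len y ≤ B) : len (x + y) ≤ B + 1 := by
  have hx' : x < 2 ^ (B - 1) := Nat.size_le.1 (by simp only [len] at hx; omega)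
  have hy' : y < 2 ^ (B - 1) := Nat.size_le.1 (by simp only [len] at hy; omega)
  have hB : 1 ≤ B := (len_pos x).trans hx
  have : Nat.size (x + y) ≤ B := Nat.size_le.2 <| by
    obtain ⟨b, rfl⟩ := Nat.exists_eq_add_of_le' hB
    rw [pow_succ]
    simp only [Nat.add_sub_cancel] at hx' hy'
    omega
  simpa [len] using this

/-- Every number stored in `σ` has length at most `B`. -/
def State.Bounded (σ : State) (B : ℕ) : Prop :=
  (∀ r, len (σ.reg r) ≤ B) ∧ ∀ k a, len (σ.mem k a) ≤ B

theorem State.Bounded.mono {σ : State} {B C : ℕ} (h : σ.Bounded B) (hBC : B ≤ C) : σ.Bounded C :=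
  ⟨fun r => (h.1 r).trans hBC, fun k a => (h.2 k a).trans hBC⟩

theorem State.Bounded.setReg {σ : State} {B v : ℕ} (h : σ.Bounded B) (hv : len v ≤ B) (r : ℕ) :
    (σ.setReg r v).Bounded B := by
  refine ⟨fun r' => ?_, h.2⟩
  simp only [State.setReg, Function.update_apply]
  split_ifs
  exacts [hv, h.1 r']

theorem State.Bounded.setMem {σ : State} {B v : ℕ} (h : σ.Bounded B) (hv : len v ≤ B) (k a : ℕ) :
    (σ.setMem k a v).Bounded B := by
  refine ⟨h.1, fun k' a' => ?_⟩
  by_cases hk : k' = k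
  · subst hk
    by_cases ha : a' = a
    · subst ha; simpa [State.setMem] using hv
    · simpa [State.setMem, ha] using h.2 k' a'
  · simpa [State.setMem, hk] using h.2 k' a'

/-- `Runs P σ τ k`: the program `P` leads from `σ` to `τ` in at most `k` unit steps. An instruction
lengthens the longest stored number by at most one bit (a constant `c` is charged `len c` steps), so
a count of unit steps bounds both the sizes in `τ` and the logarithmic cost. -/
def Runs (P : Prog) (σ τ : State) (k : ℕ) : Prop :=
  ∃ t, Exec P σ τ t ∧ ∀ B, σ.Bounded B → τ.Bounded (B + k) ∧ t ≤ 2 * k * (B + k)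

namespace Runs

variable {P Q : Prog} {σ τ υ : State} {k l : ℕ}

theorem mono (h : Runs P σ τ k) (hkl : k ≤ l) : Runs P σ τ l := by
  obtain ⟨t, ht, hB⟩ := h
  refine ⟨t, ht, fun B hσ => ⟨(hB B hσ).1.mono (by omega), (hB B hσ).2.trans ?_⟩⟩
  gcongr

theorem skip (σ : State) : Runs .skip σ σ 1 :=
  ⟨1, .skip σ, fun B h => ⟨h.mono (by omega), by omega⟩⟩

theorem const (σ : State) (r c : ℕ) : Runs (.const r c) σ (σ.setReg r c) (len c) := by
  refine ⟨_, .const σ r c, fun B h => ⟨(h.mono (by omega)).setReg (by omega) r, ?_⟩⟩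
  have := len_pos c
  nlinarith

theorem add (σ : State) (r s t : ℕ) :
    Runs (.add r s t) σ (σ.setReg r (σ.reg s + σ.reg t)) 1 :=
  ⟨_, .add σ r s t, fun B h => ⟨(h.mono (by omega)).setReg (len_add_le (h.1 s) (h.1 t)) r, by
    have := h.1 s; have := h.1 t; omega⟩⟩

theorem sub (σ : State) (r s t : ℕ) :
    Runs (.sub r s t) σ (σ.setReg r (σ.reg s - σ.reg t)) 1 :=
  ⟨_, .sub σ r s t, fun B h => ⟨(h.mono (by omega)).setReg
    ((len_mono (Nat.sub_le _ _)).trans ((h.1 s).trans (by omega))) r, by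
    have := h.1 s; have := h.1 t; omega⟩⟩

theorem load (σ : State) (r k s : ℕ) :
    Runs (.load r k s) σ (σ.setReg r (σ.mem k (σ.reg s))) 1 :=
  ⟨_, .load σ r k s, fun B h => ⟨(h.mono (by omega)).setReg ((h.2 _ _).trans (by omega)) r, by
    have := h.1 s; have := h.2 k (σ.reg s); omega⟩⟩

theorem store (σ : State) (k s r : ℕ) :
    Runs (.store k s r) σ (σ.setMem k (σ.reg s) (σ.reg r)) 1 :=
  ⟨_, .store σ k s r, fun B h => ⟨(h.mono (by omega)).setMem ((h.1 r).trans (by omega)) k _, by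
    have := h.1 s; have := h.1 r; omega⟩⟩

theorem write (σ : State) (r : ℕ) :
    Runs (.write r) σ { σ with out := σ.out ++ [σ.reg r] } 1 :=
  ⟨_, .write σ r, fun B h => ⟨h.mono (by omega), by have := h.1 r; omega⟩⟩

theorem seq (h : Runs P σ τ k) (h' : Runs Q τ υ l) : Runs (.seq P Q) σ υ (k + l) := by
  obtain ⟨t, ht, hB⟩ := h
  obtain ⟨u, hu, hC⟩ := h'
  refine ⟨_, .seq ht hu, fun B hσ => ?_⟩
  obtain ⟨hτ, h1⟩ := hB B hσ
  obtain ⟨hυ, h2⟩ := hC _ hτ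
  exact ⟨hυ.mono (by omega), by nlinarith⟩

theorem cond_true {r : ℕ} (hr : σ.reg r ≠ 0) (h : Runs P σ τ k) :
    Runs (.cond r P Q) σ τ (k + 1) := by
  obtain ⟨t, ht, hB⟩ := h
  refine ⟨_, .cond_true hr ht, fun B hσ => ?_⟩
  obtain ⟨hτ, h1⟩ := hB B hσ
  have := hσ.1 r
  exact ⟨hτ.mono (by omega), by nlinarith⟩

theorem cond_false {r : ℕ} (hr : σ.reg r = 0) (h : Runs Q σ τ k) :
    Runs (.cond r P Q) σ τ (k + 1) := by
  obtain ⟨t, ht, hB⟩ := h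
  refine ⟨_, .cond_false hr ht, fun B hσ => ?_⟩
  obtain ⟨hτ, h1⟩ := hB B hσ
  have := hσ.1 r
  exact ⟨hτ.mono (by omega), by nlinarith⟩

theorem loop_exit {r : ℕ} (hr : σ.reg r = 0) : Runs (.loop r P) σ σ 1 :=
  ⟨_, Exec.loop_stop hr, fun B hσ => ⟨hσ.mono (by omega), by have := hσ.1 r; omega⟩⟩

theorem loop_step {r : ℕ} (hr : σ.reg r ≠ 0) (h : Runs P σ τ k) (h' : Runs (.loop r P) τ υ l) :
    Runs (.loop r P) σ υ (k + l + 1) := by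
  obtain ⟨t, ht, hB⟩ := h
  obtain ⟨u, hu, hC⟩ := h'
  refine ⟨_, .loop_step hr ht hu, fun B hσ => ?_⟩
  obtain ⟨hτ, h1⟩ := hB B hσ
  obtain ⟨hυ, h2⟩ := hC _ hτ
  have := hσ.1 r
  exact ⟨hυ.mono (by omega), by nlinarith⟩

end Runs

/-! ### A language of bounded loops and its compiler -/

@[simp] theorem State.setReg_reg (σ : State) (r v r' : ℕ) :
    (σ.setReg r v).reg r' = if r' = r then v else σ.reg r' := by
  simp [State.setReg, Function.update_apply]

@[simp] theorem State.setReg_mem (σ : State) (r v : ℕ) : (σ.setReg r v).mem = σ.mem := rfl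

@[simp] theorem State.setReg_out (σ : State) (r v : ℕ) : (σ.setReg r v).out = σ.out := rfl

@[simp] theorem State.setMem_reg (σ : State) (k a v : ℕ) : (σ.setMem k a v).reg = σ.reg := rfl

@[simp] theorem State.setMem_mem (σ : State) (k a v k' : ℕ) :
    (σ.setMem k a v).mem k' = if k' = k then Function.update (σ.mem k) a v else σ.mem k' := by
  simp [State.setMem, Function.update_apply]

/-- Arithmetic expressions over variables and memory cells; `sub` is truncated subtraction. -/
inductive Ex : Type
  /-- the value of a variable -/
  | var (r : ℕ) : Ex
  /-- a literal -/
  | lit (c : ℕ) : Ex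
  /-- sum -/
  | add (e f : Ex) : Ex
  /-- truncated difference -/
  | sub (e f : Ex) : Ex
  /-- the cell of bank `k` whose address is the value of `e` -/
  | cell (k : ℕ) (e : Ex) : Ex

namespace Ex

instance : Add Ex := ⟨Ex.add⟩

instance : Sub Ex := ⟨Ex.sub⟩

instance (c : ℕ) : OfNat Ex c := ⟨Ex.lit c⟩

/-- The value of an expression in a state. -/
def eval (σ : State) : Ex → ℕ
  | var r => σ.reg r
  | lit c => c
  | add e f => e.eval σ + f.eval σ
  | sub e f => e.eval σ - f.eval σ
  | cell k e => σ.mem k (e.eval σ)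

@[simp] theorem eval_var (σ : State) (r : ℕ) : (var r).eval σ = σ.reg r := rfl

@[simp] theorem eval_ofNat (σ : State) (c : ℕ) :
    (no_index (OfNat.ofNat c) : Ex).eval σ = OfNat.ofNat c := rfl

@[simp] theorem eval_add (σ : State) (e f : Ex) : (e + f).eval σ = e.eval σ + f.eval σ := rfl

@[simp] theorem eval_sub (σ : State) (e f : Ex) : (e - f).eval σ = e.eval σ - f.eval σ := rfl

@[simp] theorem eval_cell (σ : State) (k : ℕ) (e : Ex) :
    (cell k e).eval σ = σ.mem k (e.eval σ) := rfl

/-- Code that computes an expression into the scratch register `2 * d + 1`. The variable `r` lives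
in register `2 * r`; the odd registers form a stack, whose entries below `d` are left alone. -/
def comp : Ex → ℕ → Prog
  | var r, d => .seq (.const (2 * d + 1) 0) (.add (2 * d + 1) (2 * d + 1) (2 * r))
  | lit c, d => .const (2 * d + 1) c
  | add e f, d => .seq (e.comp d)
      (.seq (f.comp (d + 1)) (.add (2 * d + 1) (2 * d + 1) (2 * (d + 1) + 1)))
  | sub e f, d => .seq (e.comp d)
      (.seq (f.comp (d + 1)) (.sub (2 * d + 1) (2 * d + 1) (2 * (d + 1) + 1)))
  | cell k e, d => .seq (e.comp d) (.load (2 * d + 1) k (2 * d + 1))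

/-- The number of unit steps of the compiled expression. -/
def steps : Ex → ℕ
  | var _ => len 0 + 1
  | lit c => len c
  | add e f => e.steps + (f.steps + 1)
  | sub e f => e.steps + (f.steps + 1)
  | cell _ e => e.steps + 1

end Ex

/-- The part of a machine state that a source program sees: variables (the even registers), memory
and output. -/
def State.view (σ : State) : State := ⟨fun r => σ.reg (2 * r), σ.mem, σ.out⟩

/-- `τ` has the same entries on the scratch stack below `d` as `σ`. -/
def SameBelow (d : ℕ) (σ τ : State) : Prop := ∀ e < d, τ.reg (2 * e + 1) = σ.reg (2 * e + 1)

theorem SameBelow.trans {d : ℕ} {σ τ υ : State} (h : SameBelow d σ τ) (h' : SameBelow d τ υ) :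
    SameBelow d σ υ := fun e he => (h' e he).trans (h e he)

theorem SameBelow.mono {c d : ℕ} {σ τ : State} (h : SameBelow d σ τ) (hc : c ≤ d) :
    SameBelow c σ τ := fun e he => h e (he.trans_le hc)

theorem view_setReg_odd (σ : State) (d v : ℕ) : (σ.setReg (2 * d + 1) v).view = σ.view := by
  have : ∀ r, 2 * r ≠ 2 * d + 1 := by omega
  simp [State.view, this]

theorem view_setReg_even (σ : State) (r v : ℕ) :
    (σ.setReg (2 * r) v).view = σ.view.setReg r v := by
  simp only [State.view, State.setReg, State.mk.injEq, and_true]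
  ext x
  simp [Function.update_apply]

theorem sameBelow_setReg_odd (σ : State) {c d : ℕ} (h : c ≤ d) (v : ℕ) :
    SameBelow c σ (σ.setReg (2 * d + 1) v) := by
  intro e he
  have : e ≠ d := by omega
  simp [this]

theorem sameBelow_setReg_even (σ : State) (c r v : ℕ) :
    SameBelow c σ (σ.setReg (2 * r) v) := by
  intro e he
  have : 2 * e + 1 ≠ 2 * r := by omega
  simp [this]

theorem Ex.comp_spec (e : Ex) (d : ℕ) (σ : State) :
    ∃ τ, Runs (e.comp d) σ τ e.steps ∧ τ.view = σ.view ∧ SameBelow d σ τ ∧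
      τ.reg (2 * d + 1) = e.eval σ.view := by
  induction e generalizing d σ with
  | var r =>
    refine ⟨_, (Runs.const _ _ _).seq (Runs.add _ _ _ _), ?_, ?_, ?_⟩
    · simp [view_setReg_odd]
    · exact (sameBelow_setReg_odd _ le_rfl _).trans (sameBelow_setReg_odd _ le_rfl _)
    · have : 2 * r ≠ 2 * d + 1 := by omega
      simp [State.view, this]
  | lit c =>
    exact ⟨_, Runs.const _ _ _, view_setReg_odd _ _ _, sameBelow_setReg_odd _ le_rfl _, by
      simp [Ex.eval]⟩
  | add e f he hf =>
    obtain ⟨τ, h1, h2, h3, h4⟩ := he d σ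
    obtain ⟨υ, k1, k2, k3, k4⟩ := hf (d + 1) τ
    refine ⟨_, h1.seq (k1.seq (Runs.add _ _ _ _)), ?_, ?_, ?_⟩
    · rw [view_setReg_odd, k2, h2]
    · exact (h3.trans (k3.mono (by omega))).trans (sameBelow_setReg_odd _ le_rfl _)
    · rw [State.setReg_reg, if_pos rfl, k4, k3 d (by omega), h4, h2]; rfl
  | sub e f he hf =>
    obtain ⟨τ, h1, h2, h3, h4⟩ := he d σ
    obtain ⟨υ, k1, k2, k3, k4⟩ := hf (d + 1) τ
    refine ⟨_, h1.seq (k1.seq (Runs.sub _ _ _ _)), ?_, ?_, ?_⟩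
    · rw [view_setReg_odd, k2, h2]
    · exact (h3.trans (k3.mono (by omega))).trans (sameBelow_setReg_odd _ le_rfl _)
    · rw [State.setReg_reg, if_pos rfl, k4, k3 d (by omega), h4, h2]; rfl
  | cell k e he =>
    obtain ⟨τ, h1, h2, h3, h4⟩ := he d σ
    refine ⟨_, h1.seq (Runs.load _ _ _ _), ?_, ?_, ?_⟩
    · rw [view_setReg_odd, h2]
    · exact h3.trans (sameBelow_setReg_odd _ le_rfl _)
    · have : τ.mem = σ.mem := (State.mk.injEq .. ▸ h2 : _ ∧ _).2.1
      rw [State.setReg_reg, if_pos rfl, h4, this]; rfl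

/-- Source programs. The only loops are `for` loops whose bound is the value of a variable, read
before the first iteration. -/
inductive Cmd : Type
  /-- do nothing -/
  | skip : Cmd
  /-- assignment to a variable -/
  | set (r : ℕ) (e : Ex) : Cmd
  /-- assignment of the value of `e` to the cell of bank `k` with address `a` -/
  | put (k : ℕ) (a e : Ex) : Cmd
  /-- output -/
  | out (e : Ex) : Cmd
  /-- sequence -/
  | seq (c d : Cmd) : Cmd
  /-- `c` if `e` is nonzero, else `d` -/
  | ite (e : Ex) (c d : Cmd) : Cmd
  /-- for `i = 0, …, b - 1` do `c`, where `i` and `b` are variables -/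
  | loop (i b : ℕ) (c : Cmd) : Cmd

namespace Cmd

/-- Sequential composition of source programs. -/
infixr:60 " ;; " => Cmd.seq

/-- The state after the execution of a source program. -/
def run : Cmd → State → State
  | skip, σ => σ
  | set r e, σ => σ.setReg r (e.eval σ)
  | put k a e, σ => σ.setMem k (a.eval σ) (e.eval σ)
  | out e, σ => { σ with out := σ.out ++ [e.eval σ] }
  | seq c d, σ => d.run (c.run σ)
  | ite e c d, σ => if e.eval σ ≠ 0 then c.run σ else d.run σ
  | .loop i b c, σ => Nat.rec σ (fun k τ => c.run (τ.setReg i k)) (σ.reg b)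

/-- Code for a source program that leaves the scratch stack below `d` alone. A loop keeps the number
of remaining iterations and the current index on the stack. -/
def comp : Cmd → ℕ → Prog
  | skip, _ => .skip
  | set r e, d => .seq (e.comp d) (.seq (.const (2 * r) 0) (.add (2 * r) (2 * r) (2 * d + 1)))
  | put k a e, d => .seq (a.comp d)
      (.seq (e.comp (d + 1)) (.store k (2 * d + 1) (2 * (d + 1) + 1)))
  | out e, d => .seq (e.comp d) (.write (2 * d + 1))
  | seq c c', d => .seq (c.comp d) (c'.comp d)
  | ite e c c', d => .seq (e.comp d) (.cond (2 * d + 1) (c.comp d) (c'.comp d))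
  | .loop i b c, d =>
    .seq (.const (2 * d + 1) 0) (.seq (.add (2 * d + 1) (2 * d + 1) (2 * b))
      (.seq (.const (2 * (d + 1) + 1) 0) (.loop (2 * d + 1)
        (.seq (.const (2 * i) 0) (.seq (.add (2 * i) (2 * i) (2 * (d + 1) + 1))
          (.seq (c.comp (d + 2)) (.seq (.const (2 * (d + 2) + 1) 1)
            (.seq (.add (2 * (d + 1) + 1) (2 * (d + 1) + 1) (2 * (d + 2) + 1))
              (.sub (2 * d + 1) (2 * d + 1) (2 * (d + 2) + 1))))))))))

/-- A bound for the number of unit steps of the compiled program, as a polynomial in a common bound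
for the numbers of iterations of its loops. -/
noncomputable def steps : Cmd → Polynomial ℕ
  | skip => 1
  | set _ e => Polynomial.C (e.steps + (len 0 + 1))
  | put _ a e => Polynomial.C (a.steps + (e.steps + 1))
  | out e => Polynomial.C (e.steps + 1)
  | seq c d => c.steps + d.steps
  | ite e c d => Polynomial.C e.steps + (c.steps + d.steps + 1)
  | .loop _ _ c => Polynomial.C (len 0 + 1 + len 0 + 1) +
      Polynomial.X * (Polynomial.C (len 0 + 1 + len 1 + 1 + 1 + 1) + c.steps)

/-- The variables that a program may change. -/
def writes : Cmd → List ℕ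
  | skip => []
  | set r _ => [r]
  | put _ _ _ => []
  | out _ => []
  | seq c d => c.writes ++ d.writes
  | ite _ c d => c.writes ++ d.writes
  | .loop i _ c => i :: c.writes

/-- The memory banks that a program may change. -/
def banks : Cmd → List ℕ
  | skip => []
  | set _ _ => []
  | put k _ _ => [k]
  | out _ => []
  | seq c d => c.banks ++ d.banks
  | ite _ c d => c.banks ++ d.banks
  | .loop _ _ c => c.banks

/-- Whether a program contains an output instruction. -/
def prints : Cmd → Bool
  | skip => false
  | set _ _ => false
  | put _ _ _ => false
  | out _ => true
  | seq c d => c.prints || d.prints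
  | ite _ c d => c.prints || d.prints
  | .loop _ _ c => c.prints

/-- The variables that serve as loop bounds. -/
def bounds : Cmd → List ℕ
  | skip => []
  | set _ _ => []
  | put _ _ _ => []
  | out _ => []
  | seq c d => c.bounds ++ d.bounds
  | ite _ c d => c.bounds ++ d.bounds
  | .loop _ b c => b :: c.bounds

/-- `τ` differs from `σ` only in those places that `c` may change. -/
structure Frame (c : Cmd) (σ τ : State) : Prop where
  /-- the other variables are unchanged -/
  reg : ∀ r, r ∉ c.writes → τ.reg r = σ.reg r
  /-- the other memory banks are unchanged -/
  mem : ∀ k, k ∉ c.banks → τ.mem k = σ.mem k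
  /-- without output instructions the output is unchanged -/
  out : c.prints = false → τ.out = σ.out

theorem Frame.refl (c : Cmd) (σ : State) : Frame c σ σ :=
  ⟨fun _ _ => rfl, fun _ _ => rfl, fun _ => rfl⟩

theorem Frame.trans {c : Cmd} {σ τ υ : State} (h : Frame c σ τ) (h' : Frame c τ υ) :
    Frame c σ υ :=
  ⟨fun r hr => (h'.reg r hr).trans (h.reg r hr), fun k hk => (h'.mem k hk).trans (h.mem k hk),
    fun ho => (h'.out ho).trans (h.out ho)⟩

theorem run_frame (c : Cmd) (σ : State) : Frame c σ (c.run σ) := by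
  induction c generalizing σ with
  | skip => exact Frame.refl _ _
  | set r e =>
    refine ⟨fun r' hr => ?_, fun _ _ => rfl, fun _ => rfl⟩
    simp only [writes, List.mem_singleton] at hr
    simp [run, hr]
  | put k a e =>
    refine ⟨fun _ _ => rfl, fun k' hk => ?_, fun _ => rfl⟩
    simp only [banks, List.mem_singleton] at hk
    simp [run, hk]
  | out e => exact ⟨fun _ _ => rfl, fun _ _ => rfl, by simp [prints]⟩
  | seq c d hc hd =>
    refine ⟨fun r hr => ?_, fun k hk => ?_, fun ho => ?_⟩
    · simp only [writes, List.mem_append, not_or] at hr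
      exact ((hd _).reg r hr.2).trans ((hc σ).reg r hr.1)
    · simp only [banks, List.mem_append, not_or] at hk
      exact ((hd _).mem k hk.2).trans ((hc σ).mem k hk.1)
    · simp only [prints, Bool.or_eq_false_iff] at ho
      exact ((hd _).out ho.2).trans ((hc σ).out ho.1)
  | ite e c d hc hd =>
    refine ⟨fun r hr => ?_, fun k hk => ?_, fun ho => ?_⟩
    · simp only [writes, List.mem_append, not_or] at hr
      simp only [run]
      split_ifs
      exacts [(hc σ).reg r hr.1, (hd σ).reg r hr.2]
    · simp only [banks, List.mem_append, not_or] at hk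
      simp only [run]
      split_ifs
      exacts [(hc σ).mem k hk.1, (hd σ).mem k hk.2]
    · simp only [prints, Bool.or_eq_false_iff] at ho
      simp only [run]
      split_ifs
      exacts [(hc σ).out ho.1, (hd σ).out ho.2]
  | loop i b c hc =>
    simp only [run]
    induction σ.reg b with
    | zero => exact Frame.refl _ _
    | succ k ih =>
      refine ih.trans ⟨fun r hr => ?_, fun k hk => ?_, fun ho => ?_⟩
      · simp only [writes, List.mem_cons, not_or] at hr
        rw [(hc _).reg r hr.2]
        simp [hr.1]
      · exact (hc _).mem k hk
      · exact (hc _).out ho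

/-- Induction along a `for` loop; the step may use that everything which the loop does not change
still has its initial value. -/
theorem loop_induction {i b : ℕ} {c : Cmd} {σ : State} (Inv : ℕ → State → Prop) (h0 : Inv 0 σ)
    (hs : ∀ k < σ.reg b, ∀ τ, Frame (.loop i b c) σ τ → Inv k τ →
      Inv (k + 1) (c.run (τ.setReg i k))) :
    Inv (σ.reg b) ((Cmd.loop i b c).run σ) := by
  let f : ℕ → State := fun N => Nat.rec σ (fun k τ => c.run (τ.setReg i k)) N
  have key : ∀ N ≤ σ.reg b, Frame (.loop i b c) σ (f N) ∧ Inv N (f N) := by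
    intro N hN
    induction N with
    | zero => exact ⟨Frame.refl _ _, h0⟩
    | succ N ih =>
      obtain ⟨hF, hI⟩ := ih (by omega)
      refine ⟨hF.trans ⟨fun r hr => ?_, fun k hk => ?_, fun ho => ?_⟩, hs N hN _ hF hI⟩
      · simp only [writes, List.mem_cons, not_or] at hr
        exact ((run_frame c _).reg r hr.2).trans ((State.setReg_reg ..).trans (if_neg hr.1))
      · exact (run_frame c _).mem k hk
      · exact (run_frame c _).out ho
  exact (key _ le_rfl).2

theorem comp_set (r : ℕ) (e : Ex) (d : ℕ) (σ : State) :
    ∃ τ, Runs ((set r e).comp d) σ τ (e.steps + (len 0 + 1)) ∧ τ.view = (set r e).run σ.view ∧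
      SameBelow d σ τ := by
  obtain ⟨τ, h1, h2, h3, h4⟩ := e.comp_spec d σ
  refine ⟨_, h1.seq ((Runs.const _ _ _).seq (Runs.add _ _ _ _)), ?_, ?_⟩
  · have : 2 * d + 1 ≠ 2 * r := by omega
    simp only [view_setReg_even, State.setReg_reg, if_true, this, if_false, h4, h2, run, zero_add]
    simp [State.setReg]
  · exact h3.trans ((sameBelow_setReg_even _ _ _ _).trans (sameBelow_setReg_even _ _ _ _))

/-- Correctness and running time of the compiler, for programs that do not change the variables that
bound their loops. -/
theorem comp_spec (V : List ℕ) (N : ℕ) (c : Cmd) (hw : ∀ r ∈ c.writes, r ∉ V)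
    (hb : ∀ r ∈ c.bounds, r ∈ V) (d : ℕ) (σ : State) (hN : ∀ r ∈ V, σ.view.reg r ≤ N) :
    ∃ τ, Runs (c.comp d) σ τ (c.steps.eval N) ∧ τ.view = c.run σ.view ∧ SameBelow d σ τ := by
  induction c generalizing d σ with
  | skip => exact ⟨σ, (Runs.skip σ).mono (by simp [steps]), rfl, fun _ _ => rfl⟩
  | set r e => simpa only [steps, Polynomial.eval_C] using comp_set r e d σ
  | put k a e =>
    obtain ⟨τ, h1, h2, h3, h4⟩ := a.comp_spec d σ
    obtain ⟨υ, k1, k2, k3, k4⟩ := e.comp_spec (d + 1) τ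
    refine ⟨_, (h1.seq (k1.seq (Runs.store _ _ _ _))).mono (by simp [steps]), ?_, ?_⟩
    · have : (υ.setMem k (υ.reg (2 * d + 1)) (υ.reg (2 * (d + 1) + 1))).view =
        υ.view.setMem k (υ.reg (2 * d + 1)) (υ.reg (2 * (d + 1) + 1)) := rfl
      rw [this, k4, k3 d (by omega), h4, k2, h2]; rfl
    · exact h3.trans (k3.mono (by omega))
  | out e =>
    obtain ⟨τ, h1, h2, h3, h4⟩ := e.comp_spec d σ
    refine ⟨_, (h1.seq (Runs.write _ _)).mono (by simp [steps]), ?_, h3⟩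
    change ({ τ.view with out := τ.view.out ++ [τ.reg (2 * d + 1)] } : State) = _
    rw [h4, h2]; rfl
  | seq c c' hc hc' =>
    simp only [writes, bounds, List.mem_append] at hw hb
    obtain ⟨τ, h1, h2, h3⟩ := hc (fun r hr => hw r (.inl hr)) (fun r hr => hb r (.inl hr)) d σ hN
    obtain ⟨υ, k1, k2, k3⟩ := hc' (fun r hr => hw r (.inr hr)) (fun r hr => hb r (.inr hr)) d τ
      (fun r hr => by
        rw [h2, (run_frame c _).reg r fun hr' => hw r (.inl hr') hr]
        exact hN r hr)
    refine ⟨υ, (h1.seq k1).mono (by simp [steps]), ?_, h3.trans k3⟩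
    rw [k2, h2]; rfl
  | ite e c c' hc hc' =>
    simp only [writes, bounds, List.mem_append] at hw hb
    obtain ⟨τ, h1, h2, h3, h4⟩ := e.comp_spec d σ
    by_cases h0 : e.eval σ.view = 0
    · obtain ⟨υ, k1, k2, k3⟩ := hc' (fun r hr => hw r (.inr hr)) (fun r hr => hb r (.inr hr)) d τ
        (by rwa [h2])
      refine ⟨υ, (h1.seq (Runs.cond_false (by rw [h4, h0]) k1)).mono ?_, ?_, h3.trans k3⟩
      · simp only [steps, Polynomial.eval_add, Polynomial.eval_C, Polynomial.eval_one]; omega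
      · simp [k2, h2, run, h0]
    · obtain ⟨υ, k1, k2, k3⟩ := hc (fun r hr => hw r (.inl hr)) (fun r hr => hb r (.inl hr)) d τ
        (by rwa [h2])
      refine ⟨υ, (h1.seq (Runs.cond_true (by rwa [h4]) k1)).mono ?_, ?_, h3.trans k3⟩
      · simp only [steps, Polynomial.eval_add, Polynomial.eval_C, Polynomial.eval_one]; omega
      · simp [k2, h2, run, h0]
  | loop i b c hc =>
    simp only [writes, bounds, List.mem_cons] at hw hb
    have hw' : ∀ r ∈ c.writes, r ∉ V := fun r hr => hw r (.inr hr)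
    have hb' : ∀ r ∈ c.bounds, r ∈ V := fun r hr => hb r (.inr hr)
    have hbV : b ∈ V := hb b (.inl rfl)
    have hiV : i ∉ V := hw i (.inl rfl)
    set K := len 0 + 1 + len 1 + 1 + 1 + 1 + c.steps.eval N with hK
    -- the loop proper, by induction on the number of remaining iterations
    have iterate : ∀ rem k, ∀ υ : State, υ.reg (2 * d + 1) = rem → υ.reg (2 * (d + 1) + 1) = k →
        (∀ r ∈ V, υ.view.reg r ≤ N) → ∃ τ, Runs (.loop (2 * d + 1)
          (.seq (.const (2 * i) 0) (.seq (.add (2 * i) (2 * i) (2 * (d + 1) + 1))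
          (.seq (c.comp (d + 2)) (.seq (.const (2 * (d + 2) + 1) 1)
            (.seq (.add (2 * (d + 1) + 1) (2 * (d + 1) + 1) (2 * (d + 2) + 1))
              (.sub (2 * d + 1) (2 * d + 1) (2 * (d + 2) + 1)))))))) υ τ (rem * K + 1) ∧
          τ.view = Nat.rec υ.view (fun j s => c.run (s.setReg i (k + j))) rem ∧
          SameBelow d υ τ := by
      intro rem
      induction rem with
      | zero =>
        intro k υ h0 _ _
        exact ⟨υ, by simpa using Runs.loop_exit h0, rfl, fun _ _ => rfl⟩
      | succ rem ih =>
        intro k υ h0 h1 hV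
        set υ₁ := (υ.setReg (2 * i) 0) with hυ₁
        set υ₂ := υ₁.setReg (2 * i) (υ₁.reg (2 * i) + υ₁.reg (2 * (d + 1) + 1)) with hυ₂
        have e1 : ∀ e, 2 * e + 1 ≠ 2 * i := by omega
        have hview : υ₂.view = υ.view.setReg i k := by
          simp only [hυ₂, view_setReg_even, hυ₁, State.setReg_reg, if_true, e1, if_false, h1,
            zero_add]
          simp [State.setReg]
        have hodd : ∀ e, υ₂.reg (2 * e + 1) = υ.reg (2 * e + 1) := by
          intro e; simp [hυ₂, hυ₁, e1]
        obtain ⟨τ, k1, k2, k3⟩ := hc hw' hb' (d + 2) υ₂ (fun r hr => by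
          rw [hview, State.setReg_reg, if_neg (ne_of_mem_of_not_mem hr hiV)]; exact hV r hr)
        set τ₁ := τ.setReg (2 * (d + 2) + 1) 1 with hτ₁
        set τ₂ := τ₁.setReg (2 * (d + 1) + 1)
          (τ₁.reg (2 * (d + 1) + 1) + τ₁.reg (2 * (d + 2) + 1)) with hτ₂
        set τ₃ := τ₂.setReg (2 * d + 1) (τ₂.reg (2 * d + 1) - τ₂.reg (2 * (d + 2) + 1)) with hτ₃
        have hτv : τ₃.view = c.run (υ.view.setReg i k) := by
          rw [hτ₃, view_setReg_odd, hτ₂, view_setReg_odd, hτ₁, view_setReg_odd, k2, hview]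
        have a1 : τ₃.reg (2 * d + 1) = rem := by
          have : τ.reg (2 * d + 1) = rem + 1 := by rw [k3 d (by omega), hodd, h0]
          simp [hτ₃, hτ₂, hτ₁, this]
        have a2 : τ₃.reg (2 * (d + 1) + 1) = k + 1 := by
          have : τ.reg (2 * (d + 1) + 1) = k := by rw [k3 (d + 1) (by omega), hodd, h1]
          simp [hτ₃, hτ₂, hτ₁, this]
        obtain ⟨ω, l1, l2, l3⟩ := ih (k + 1) τ₃ a1 a2 (fun r hr => by
          rw [hτv, (run_frame c _).reg r (fun h => hw' r h hr), State.setReg_reg,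
            if_neg (ne_of_mem_of_not_mem hr hiV)]
          exact hV r hr)
        refine ⟨ω, (Runs.loop_step (by rw [h0]; omega) ((Runs.const _ _ _).seq
          ((Runs.add _ _ _ _).seq (k1.seq ((Runs.const _ _ _).seq
            ((Runs.add _ _ _ _).seq (Runs.sub _ _ _ _)))))) l1).mono ?_, ?_, ?_⟩
        · rw [Nat.succ_mul, hK]; omega
        · rw [l2, hτv]
          clear * -
          induction rem with
          | zero => rfl
          | succ rem ih =>
            simp only at ih ⊢
            rw [ih, show k + 1 + rem = k + (rem + 1) by omega]
        · refine SameBelow.trans (fun e he => ?_) l3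
          have c0 : τ.reg (2 * e + 1) = υ.reg (2 * e + 1) := by rw [k3 e (by omega), hodd]
          have c1 : e ≠ d := by omega
          have c2 : e ≠ d + 1 := by omega
          have c3 : e ≠ d + 2 := by omega
          simp [hτ₃, hτ₂, hτ₁, c0, c1, c2, c3]
    set σ₁ := σ.setReg (2 * d + 1) 0 with hσ₁
    set σ₂ := σ₁.setReg (2 * d + 1) (σ₁.reg (2 * d + 1) + σ₁.reg (2 * b)) with hσ₂
    set σ₃ := σ₂.setReg (2 * (d + 1) + 1) 0 with hσ₃
    have hv : σ₃.view = σ.view := by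
      rw [hσ₃, view_setReg_odd, hσ₂, view_setReg_odd, hσ₁, view_setReg_odd]
    have b1 : σ₃.reg (2 * d + 1) = σ.view.reg b := by
      have : 2 * b ≠ 2 * d + 1 := by omega
      simp [hσ₃, hσ₂, hσ₁, this, State.view]
    obtain ⟨τ, h1, h2, h3⟩ := iterate (σ.view.reg b) 0 σ₃ b1 (by simp [hσ₃]) (by rwa [hv])
    refine ⟨τ, ((Runs.const _ _ _).seq ((Runs.add _ _ _ _).seq
      ((Runs.const _ _ _).seq h1))).mono ?_, ?_, SameBelow.trans (fun e he => ?_) h3⟩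
    · have := Nat.mul_le_mul_right K (hN b hbV)
      simp only [steps, Polynomial.eval_add, Polynomial.eval_mul, Polynomial.eval_X,
        Polynomial.eval_C, ← hK]
      omega
    · rw [h2, hv]
      simp only [run, zero_add]
    · have c1 : e ≠ d := by omega
      have c2 : e ≠ d + 1 := by omega
      simp [hσ₃, hσ₂, hσ₁, c1, c2]

end Cmd

end RAM

namespace OrSched

open Finset

/-! ### Unit jobs on natural indices -/

/-- The combinatorial data of an instance with unit processing times: the jobs are the numbers below
`n`, there are `m` machines, and arc number `e < a` leads from `tl e` to `hd e`. -/
structure Data where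
  /-- number of jobs -/
  n : ℕ
  /-- number of machines -/
  m : ℕ
  /-- number of arcs -/
  a : ℕ
  /-- release dates -/
  rel : ℕ → ℕ
  /-- tails of the arcs -/
  tl : ℕ → ℕ
  /-- heads of the arcs -/
  hd : ℕ → ℕ

namespace Data

variable (D : Data)

/-- `i` is a predecessor of `j`. -/
def Arc (i j : ℕ) : Prop := ∃ e < D.a, D.tl e = i ∧ D.hd e = j

/-- All arcs join jobs. -/
def Valid : Prop := ∀ i j, D.Arc i j → i < D.n ∧ j < D.n

/-- Feasible start times and machines; values at numbers that are not jobs are irrelevant. -/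
structure Feas (st : ℕ → ℝ) (mc : ℕ → ℕ) : Prop where
  /-- the machines exist -/
  lt : ∀ j < D.n, mc j < D.m
  /-- each machine processes only one job at a time -/
  disjoint : ∀ i < D.n, ∀ j < D.n, i ≠ j → mc i = mc j → st i + 1 ≤ st j ∨ st j + 1 ≤ st i
  /-- no job starts before its release date -/
  release : ∀ j < D.n, (D.rel j : ℝ) ≤ st j
  /-- a job with predecessors starts after the completion of one of them -/
  or_prec : ∀ j < D.n, (∃ p, D.Arc p j) → ∃ p, D.Arc p j ∧ st p + 1 ≤ st j

/-- There is a nonempty set of jobs each of which has predecessors, all of them in the set. No job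
of such a set can be the first of the set to start. -/
def Stuck : Prop :=
  ∃ R : ℕ → Prop, (∃ j < D.n, R j) ∧
    ∀ j < D.n, R j → (∃ p, D.Arc p j) ∧ ∀ p, D.Arc p j → R p

variable {D}

theorem Stuck.not_feas (hV : D.Valid) (h : D.Stuck) (st : ℕ → ℝ) (mc : ℕ → ℕ) :
    ¬ D.Feas st mc := by
  classical
  intro hF
  obtain ⟨R, ⟨j₀, hj₀, hR₀⟩, hR⟩ := h
  obtain ⟨j, hj, hmin⟩ := ((range D.n).filter R).exists_min_image st
    ⟨j₀, by simp [hj₀, hR₀]⟩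
  simp only [mem_filter, mem_range] at hj hmin
  obtain ⟨p, hp, hlt⟩ := hF.or_prec j hj.1 (hR j hj.1 hj.2).1
  have := hmin p ⟨(hV p j hp).1, (hR j hj.1 hj.2).2 p hp⟩
  linarith

/-! ### Earliest start times by Dijkstra's algorithm -/

/-- The state of the search after `k` rounds. `ord` lists the selected jobs (those with
`sel j ≠ 0`), and `un j = 0` says that `j` is reached, i.e. has no predecessors or a selected one.
For a reached job, `key j` is the earliest start time on unlimitedly many machines, and `par j` is
`p + 1` for the first selected predecessor `p`, or `0` for a job without predecessors. -/
structure Reach (D : Data) (k : ℕ) (un key par ord sel : ℕ → ℕ) : Prop where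
  ord_lt : ∀ i < k, ord i < D.n
  sel_iff : ∀ j < D.n, sel j ≠ 0 ↔ ∃ i < k, ord i = j
  inj : ∀ i < k, ∀ i' < k, ord i = ord i' → i = i'
  sorted : ∀ i' < k, ∀ i ≤ i', key (ord i) ≤ key (ord i')
  frontier : ∀ i < k, ∀ j < D.n, un j = 0 → sel j = 0 → key (ord i) ≤ key j
  sel_un : ∀ j < D.n, sel j ≠ 0 → un j = 0
  unreached : ∀ j < D.n, un j ≠ 0 → key j = D.rel j ∧ par j = 0 ∧ (∃ p, D.Arc p j) ∧
    ∀ p, D.Arc p j → sel p = 0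
  reached : ∀ j < D.n, un j = 0 → ((∀ p, ¬ D.Arc p j) ∧ par j = 0 ∧ key j = D.rel j) ∨
    ∃ p, D.Arc p j ∧ sel p ≠ 0 ∧ par j = p + 1 ∧ key j = max (D.rel j) (key p + 1) ∧
      ∀ p', D.Arc p' j → sel p' ≠ 0 → key p ≤ key p'

theorem Reach.init {un key par ord sel : ℕ → ℕ}
    (hun : ∀ j, un j ≠ 0 ↔ ∃ e < D.a, D.hd e = j) (hkey : ∀ j < D.n, key j = D.rel j)
    (hpar : ∀ j, par j = 0) (hsel : ∀ j, sel j = 0) : Reach D 0 un key par ord sel where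
  ord_lt := by simp
  sel_iff := by simp [hsel]
  inj := by simp
  sorted := by simp
  frontier := by simp
  sel_un := by simp [hsel]
  unreached j hj hu := by
    obtain ⟨e, he, h⟩ := (hun j).1 hu
    exact ⟨hkey j hj, hpar j, ⟨D.tl e, e, he, rfl, h⟩, fun p _ => hsel p⟩
  reached j hj hu := by
    refine .inl ⟨?_, hpar j, hkey j hj⟩
    rintro p ⟨e, he, -, h⟩
    exact (hun j).2 ⟨e, he, h⟩ hu

/-- One round: a reached unselected job `b` with minimal key is selected, and its unreached
successors become reached. -/
theorem Reach.step {k b : ℕ} {un key par ord sel un' key' par' ord' sel' : ℕ → ℕ}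
    (hV : D.Valid) (h : Reach D k un key par ord sel) (hb : b < D.n) (hub : un b = 0)
    (hsb : sel b = 0) (hmin : ∀ j < D.n, un j = 0 → sel j = 0 → key b ≤ key j)
    (hord : ∀ i, ord' i = if i = k then b else ord i)
    (hsel : ∀ j, sel' j = if j = b then 1 else sel j)
    (hnew : ∀ j, un j ≠ 0 → D.Arc b j →
      un' j = 0 ∧ key' j = max (key j) (key b + 1) ∧ par' j = b + 1)
    (hold : ∀ j, ¬ (un j ≠ 0 ∧ D.Arc b j) → un' j = un j ∧ key' j = key j ∧ par' j = par j) :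
    Reach D (k + 1) un' key' par' ord' sel' := by
  have hk : ∀ j, un j = 0 → un' j = 0 ∧ key' j = key j ∧ par' j = par j := by
    intro j hj
    have := hold j (by simp [hj])
    exact ⟨this.1.trans hj, this.2⟩
  have hordk : ord' k = b := by simp [hord]
  have hordi : ∀ i < k, ord' i = ord i := fun i hi => by simp [hord, hi.ne]
  have huno : ∀ i < k, un (ord i) = 0 := fun i hi =>
    h.sel_un _ (h.ord_lt i hi) ((h.sel_iff _ (h.ord_lt i hi)).2 ⟨i, hi, rfl⟩)
  have hne : ∀ i < k, ord i ≠ b := fun i hi hib =>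
    (h.sel_iff b hb).2 ⟨i, hi, hib⟩ hsb
  have hkb : key' b = key b := (hk b hub).2.1
  have hko : ∀ i < k, key' (ord' i) = key (ord i) := fun i hi => by
    rw [hordi i hi, (hk _ (huno i hi)).2.1]
  have hob : ∀ i < k, key (ord i) ≤ key b := fun i hi => h.frontier i hi b hb hub hsb
  have hselb : sel' b ≠ 0 := by simp [hsel]
  have hself : ∀ j, sel' j ≠ 0 → j = b ∨ sel j ≠ 0 := by
    intro j hj
    rw [hsel] at hj
    split_ifs at hj with h1
    exacts [.inl h1, .inr hj]
  have hself' : ∀ j, sel j ≠ 0 → sel' j ≠ 0 := by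
    intro j hj
    rw [hsel]
    split_ifs
    exacts [one_ne_zero, hj]
  have hkp : ∀ p j, D.Arc p j → sel p ≠ 0 → key' p = key p := fun p j hp hs =>
    (hk p (h.sel_un p (hV p j hp).1 hs)).2.1
  have hsk : ∀ p < D.n, sel p ≠ 0 → key p ≤ key b := by
    intro p hp hs
    obtain ⟨i, hi, rfl⟩ := (h.sel_iff p hp).1 hs
    exact hob i hi
  refine ⟨?_, ?_, ?_, ?_, ?_, ?_, ?_, ?_⟩
  · intro i hi
    rcases Nat.lt_succ_iff_lt_or_eq.1 hi with hi | rfl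
    · rw [hordi i hi]; exact h.ord_lt i hi
    · rwa [hordk]
  · intro j hj
    constructor
    · intro hs
      rcases hself j hs with rfl | hs
      · exact ⟨k, by omega, hordk⟩
      · obtain ⟨i, hi, rfl⟩ := (h.sel_iff j hj).1 hs
        exact ⟨i, by omega, hordi i hi⟩
    · rintro ⟨i, hi, rfl⟩
      rcases Nat.lt_succ_iff_lt_or_eq.1 hi with hi | rfl
      · rw [hordi i hi] at hj ⊢
        exact hself' _ ((h.sel_iff _ hj).2 ⟨i, hi, rfl⟩)
      · rwa [hordk]
  · intro i hi i' hi' he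
    rcases Nat.lt_succ_iff_lt_or_eq.1 hi with hi | rfl <;>
      rcases Nat.lt_succ_iff_lt_or_eq.1 hi' with hi' | rfl
    · rw [hordi i hi, hordi i' hi'] at he
      exact h.inj i hi i' hi' he
    · rw [hordi i hi, hordk] at he
      exact absurd he (hne i hi)
    · rw [hordi i' hi', hordk] at he
      exact absurd he.symm (hne i' hi')
    · rfl
  · intro i' hi' i hi
    rcases Nat.lt_succ_iff_lt_or_eq.1 hi' with hi' | rfl
    · rw [hko i (by omega), hko i' hi']
      exact h.sorted i' hi' i hi
    · rcases hi.lt_or_eq with hi | rfl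
      · rw [hko i hi, hordk, hkb]
        exact hob i hi
      · exact le_rfl
  · intro i hi j hj hu hs
    have hs' : sel j = 0 := by
      by_contra h'
      exact hself' j h' hs
    have hib : key' (ord' i) ≤ key b := by
      rcases Nat.lt_succ_iff_lt_or_eq.1 hi with hi | rfl
      · rw [hko i hi]; exact hob i hi
      · rw [hordk, hkb]
    refine hib.trans ?_
    by_cases hc : un j ≠ 0 ∧ D.Arc b j
    · rw [(hnew j hc.1 hc.2).2.1]
      exact (Nat.le_succ _).trans (le_max_right _ _)
    · obtain ⟨h1, h2, -⟩ := hold j hc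
      rw [h2]
      exact hmin j hj (h1.symm.trans hu) hs'
  · intro j hj hs
    rcases hself j hs with rfl | hs
    · exact (hk _ hub).1
    · exact (hk _ (h.sel_un j hj hs)).1
  · intro j hj hu
    have hc : ¬ (un j ≠ 0 ∧ D.Arc b j) := fun hc => hu (hnew j hc.1 hc.2).1
    obtain ⟨h1, h2, h3⟩ := hold j hc
    rw [h1] at hu
    obtain ⟨g1, g2, g3, g4⟩ := h.unreached j hj hu
    refine ⟨h2.trans g1, h3.trans g2, g3, fun p hp => ?_⟩
    have hpb : p ≠ b := by
      rintro rfl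
      exact hc ⟨hu, hp⟩
    rw [hsel, if_neg hpb]
    exact g4 p hp
  · intro j hj hu
    by_cases hc : un j ≠ 0 ∧ D.Arc b j
    · obtain ⟨-, h2, h3⟩ := hnew j hc.1 hc.2
      obtain ⟨g1, -, -, g4⟩ := h.unreached j hj hc.1
      refine .inr ⟨b, hc.2, hselb, h3, by rw [h2, g1, hkb], fun p' hp' hs => ?_⟩
      rcases hself p' hs with rfl | hs
      · exact le_rfl
      · exact absurd (g4 p' hp') hs
    · obtain ⟨h1, h2, h3⟩ := hold j hc
      rcases h.reached j hj (h1.symm.trans hu) with ⟨g1, g2, g3⟩ | ⟨p, g1, g2, g3, g4, g5⟩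
      · exact .inl ⟨g1, h3.trans g2, h2.trans g3⟩
      · refine .inr ⟨p, g1, hself' p g2, h3.trans g3, by rw [h2, g4, hkp p j g1 g2],
          fun p' hp' hs => ?_⟩
        rw [hkp p j g1 g2]
        rcases hself p' hs with rfl | hs
        · rw [hkb]; exact hsk p (hV p j g1).1 g2
        · rw [hkp p' j hp' hs]
          exact g5 p' hp' hs

/-- If no job can be selected before all are, then the unreached jobs form a stuck set. -/
theorem Reach.stuck {k : ℕ} {un key par ord sel : ℕ → ℕ} (hV : D.Valid)
    (h : Reach D k un key par ord sel) (hk : k < D.n)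
    (hnone : ∀ j < D.n, un j = 0 → sel j ≠ 0) : D.Stuck := by
  refine ⟨fun j => un j ≠ 0, ?_, fun j hj hu => ?_⟩
  · by_contra! hall
    have hsub : range D.n ⊆ (range k).image ord := fun j hj => by
      rw [mem_range] at hj
      obtain ⟨i, hi, rfl⟩ := (h.sel_iff j hj).1 (hnone j hj (hall j hj))
      exact mem_image_of_mem _ (mem_range.2 hi)
    have := (card_le_card hsub).trans card_image_le
    simp only [card_range] at this
    omega
  · obtain ⟨-, -, g3, g4⟩ := h.unreached j hj hu
    exact ⟨g3, fun p hp hup => hnone p (hV p j hp).1 hup (g4 p hp)⟩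

section Complete

variable {un key par ord sel : ℕ → ℕ}

theorem Reach.exists_ord (h : Reach D D.n un key par ord sel) {j : ℕ} (hj : j < D.n) :
    ∃ i < D.n, ord i = j := by
  have : (range D.n).image ord = range D.n := by
    refine eq_of_subset_of_card_le (fun x hx => ?_) ?_
    · obtain ⟨i, hi, rfl⟩ := mem_image.1 hx
      exact mem_range.2 (h.ord_lt i (mem_range.1 hi))
    · rw [card_image_of_injOn]
      intro i hi i' hi' he
      exact h.inj i (by simpa using hi) i' (by simpa using hi') he
  have hj' : j ∈ (range D.n).image ord := by rw [this]; exact mem_range.2 hj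
  obtain ⟨i, hi, rfl⟩ := mem_image.1 hj'
  exact ⟨i, mem_range.1 hi, rfl⟩

theorem Reach.sel_ne_zero (h : Reach D D.n un key par ord sel) {j : ℕ} (hj : j < D.n) :
    sel j ≠ 0 := (h.sel_iff j hj).2 (h.exists_ord hj)

theorem Reach.rel_le_key (h : Reach D D.n un key par ord sel) {j : ℕ} (hj : j < D.n) :
    D.rel j ≤ key j := by
  rcases h.reached j hj (h.sel_un j hj (h.sel_ne_zero hj)) with ⟨-, -, g⟩ | ⟨p, -, -, -, g, -⟩
  · exact g.ge
  · rw [g]; exact le_max_left _ _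

theorem Reach.key_par (h : Reach D D.n un key par ord sel) {j p : ℕ} (hj : j < D.n)
    (hp : par j = p + 1) : D.Arc p j ∧ key p + 1 ≤ key j := by
  rcases h.reached j hj (h.sel_un j hj (h.sel_ne_zero hj)) with
    ⟨-, g, -⟩ | ⟨p', g1, -, g3, g4, -⟩
  · omega
  · obtain rfl : p' = p := by omega
    exact ⟨g1, by rw [g4]; exact le_max_right _ _⟩

theorem Reach.exists_par (h : Reach D D.n un key par ord sel) {j : ℕ} (hj : j < D.n)
    (hp : ∃ p, D.Arc p j) : ∃ p, par j = p + 1 := by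
  rcases h.reached j hj (h.sel_un j hj (h.sel_ne_zero hj)) with ⟨g, -, -⟩ | ⟨p, -, -, g, -⟩
  · exact absurd hp.choose_spec (g _)
  · exact ⟨p, g⟩

theorem Reach.key_le_start (hV : D.Valid) (h : Reach D D.n un key par ord sel) {st : ℕ → ℝ}
    {mc : ℕ → ℕ} (hF : D.Feas st mc) {j : ℕ} (hj : j < D.n) : (key j : ℝ) ≤ st j := by
  by_contra! hlt
  -- a violating job with minimal start time
  obtain ⟨i, hi, hmin⟩ := ((range D.n).filter fun i => st i < key i).exists_min_image st
    ⟨j, by simp [hj, hlt]⟩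
  simp only [mem_filter, mem_range] at hi hmin
  rcases h.reached i hi.1 (h.sel_un i hi.1 (h.sel_ne_zero hi.1)) with
    ⟨-, -, g⟩ | ⟨p, g1, g2, g3, g4, g5⟩
  · have := hF.release i hi.1
    rw [← g] at this
    linarith [hi.2]
  · obtain ⟨p', hp', hst⟩ := hF.or_prec i hi.1 ⟨p, g1⟩
    have hp'n := (hV p' i hp').1
    have h1 : (key p' : ℝ) ≤ st p' := by
      by_contra! hc
      linarith [hmin p' ⟨hp'n, hc⟩]
    have h2 : (key p : ℝ) ≤ key p' := by exact_mod_cast g5 p' hp' (h.sel_ne_zero hp'n)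
    have h3 := hF.release i hi.1
    have h4 : (key i : ℝ) ≤ st i := by
      rw [g4]
      push_cast
      exact max_le h3 (by linarith)
    linarith [hi.2]

end Complete

end Data

/-! ### Greedy placement respects deadlines -/

/-- Jobs `0, 1, …` with nondecreasing deadlines `D` are placed one after the other into unit slots
of capacity `m`; `f i` is the slot of `i`. The relation `P` assigns to a job its only successor,
whose deadline is later; a job `i` skips a slot `s` only if the slot is full, or if `s ≤ f i'` for a
job `i'` of which `i` is the successor. If at most `m * (d + 1)` jobs have a deadline `≤ d`, for
every `d`, then all deadlines are met. -/
theorem greedy_le_deadline {n m : ℕ} {f D : ℕ → ℕ} {P : ℕ → ℕ → Prop}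
    (hP : Relator.RightUnique P) (hPD : ∀ i a, P i a → D i < D a)
    (hD : ∀ i' < n, ∀ i ≤ i', D i ≤ D i')
    (hall : ∀ d, #{i ∈ range n | D i ≤ d} ≤ m * (d + 1))
    (hcap : ∀ i < n, ∀ s, #{i' ∈ range i | f i' = s} ≤ m)
    (hf : ∀ i < n, ∀ s < f i, #{i' ∈ range i | f i' = s} = m ∨ ∃ i' < i, P i' i ∧ s ≤ f i') :
    ∀ i < n, f i ≤ D i := by
  intro i
  induction i using Nat.strong_induction_on with
  | _ i ih =>
  intro hi
  by_contra! hlt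
  have count : ∀ I : Finset ℕ, (∀ s ∈ I, #{i' ∈ range i | f i' = s} = m) →
      #{i' ∈ range i | f i' ∈ I} = m * #I := by
    intro I hI
    rw [card_eq_sum_card_fiberwise (f := f) (t := I) (by intro x hx; simp_all)]
    rw [mul_comm, ← smul_eq_mul, ← sum_const]
    refine sum_congr rfl fun s hs => ?_
    rw [← hI s hs, filter_filter]
    congr 1
    ext x
    simp only [mem_filter, mem_range]
    constructor
    · tauto
    · rintro ⟨h1, rfl⟩; exact ⟨h1, hs, rfl⟩
  by_cases hfull : ∀ s ∈ range (D i + 1), #{i' ∈ range i | f i' = s} = m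
  · have h1 := count _ hfull
    rw [card_range] at h1
    have h2 : insert i {i' ∈ range i | f i' ∈ range (D i + 1)} ⊆ {i' ∈ range n | D i' ≤ D i} := by
      intro x hx
      simp only [mem_insert, mem_filter, mem_range] at hx ⊢
      rcases hx with rfl | ⟨hx, -⟩
      · exact ⟨hi, le_rfl⟩
      · exact ⟨hx.trans hi, hD i hi x hx.le⟩
    have h3 := (card_le_card h2).trans (hall (D i))
    rw [card_insert_of_notMem (by simp), h1] at h3
    omega
  · -- `s` is the last slot up to the deadline that is not full
    push Not at hfull
    obtain ⟨s, hs, hmax⟩ := ((range (D i + 1)).filter fun s =>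
      #{i' ∈ range i | f i' = s} ≠ m).exists_max_image id (by
        obtain ⟨s, hs, h⟩ := hfull
        exact ⟨s, by simp only [mem_filter]; exact ⟨hs, h⟩⟩)
    simp only [mem_filter, mem_range, id] at hs hmax
    have hlts : #{i' ∈ range i | f i' = s} < m := lt_of_le_of_ne (hcap i hi s) hs.2
    have desc : ∀ x ≤ i, s < f x → ∃ y < i, f y = s ∧ Relation.ReflTransGen P y x := by
      intro x
      induction x using Nat.strong_induction_on with
      | _ x ihx =>
      intro hx hsx
      rcases hf x (by omega) s hsx with h | ⟨y, hyx, hy, hsy⟩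
      · have : #{i' ∈ range x | f i' = s} ≤ #{i' ∈ range i | f i' = s} :=
          card_le_card (filter_subset_filter _ (range_mono hx))
        omega
      · rcases hsy.lt_or_eq with hsy | hsy
        · obtain ⟨z, hz, hfz, hzy⟩ := ihx y hyx (by omega) hsy
          exact ⟨z, hz, hfz, hzy.tail hy⟩
        · exact ⟨y, by omega, hsy.symm, .single hy⟩
    have hmono : ∀ x y, Relation.ReflTransGen P x y → x = y ∨ D x < D y := by
      intro x y hxy
      induction hxy with
      | refl => exact .inl rfl
      | tail _ h ih =>
        rcases ih with rfl | ih
        · exact .inr (hPD _ _ h)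
        · exact .inr (ih.trans (hPD _ _ h))
    choose! g hg using desc
    set X := insert i {i' ∈ range i | f i' ∈ Ioc s (D i)} with hX
    have hXmem : ∀ x ∈ X, x ≤ i ∧ s < f x := by
      intro x hx
      simp only [hX, mem_insert, mem_filter, mem_range, mem_Ioc] at hx
      rcases hx with rfl | ⟨h1, h2, -⟩
      · exact ⟨le_rfl, by omega⟩
      · exact ⟨h1.le, h2⟩
    have hcard : #X = m * (D i - s) + 1 := by
      rw [hX, card_insert_of_notMem (by simp), count, Nat.card_Ioc]
      intro t ht
      rw [mem_Ioc] at ht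
      by_contra hne
      have := hmax t ⟨by omega, hne⟩
      omega
    -- the ancestors of a job in slot `s` have distinct deadlines
    have hinj : Set.InjOn (fun x => (D x, g x)) X := by
      intro x hx y hy hxy
      simp only [Prod.mk.injEq] at hxy
      obtain ⟨hx1, hx2⟩ := hXmem x hx
      obtain ⟨hy1, hy2⟩ := hXmem y hy
      have h1 := (hg x hx1 hx2).2.2
      have h2 := (hg y hy1 hy2).2.2
      rw [← hxy.2] at h2
      rcases Relation.ReflTransGen.total_of_right_unique hP h1 h2 with h | h
      · rcases hmono _ _ h with h | h
        · exact h
        · omega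
      · rcases hmono _ _ h with h | h
        · exact h.symm
        · omega
    have hmaps : Set.MapsTo (fun x => (D x, g x)) X
        (Ioc s (D i) ×ˢ {i' ∈ range i | f i' = s} : Finset (ℕ × ℕ)) := by
      intro x hx
      obtain ⟨hx1, hx2⟩ := hXmem x hx
      obtain ⟨h1, h2, h3⟩ := hg x hx1 hx2
      simp only [mem_coe, mem_product, mem_Ioc, mem_filter, mem_range]
      refine ⟨⟨?_, hD i hi x hx1⟩, h1, h2⟩
      rcases hmono _ _ h3 with h | h
      · rw [h] at h2; omega
      · have := ih _ h1 (by omega)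
        omega
    have hle := card_le_card_of_injOn _ hmaps hinj
    rw [card_product, Nat.card_Ioc, hcard] at hle
    have := Nat.mul_le_mul_left (D i - s) hlts.le
    rw [mul_comm m] at hle
    omega

/-! ### Placing the jobs from the end of the schedule -/

/-- The state after the jobs `q 0, …, q (k - 1)` have been placed. The slots are counted backwards
from the end of the schedule; `off j` and `mc j` are the slot and the machine of `j`, `cap s` is the
number of jobs in slot `s`, `fl (p + 1)` is the first slot after those of the children of `p`, and
`T` is the largest value of `off j + key j`. -/
structure Placed (m : ℕ) (q par key : ℕ → ℕ) (k : ℕ) (off mc cap fl : ℕ → ℕ) (T : ℕ) : Prop where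
  cap_eq : ∀ s, cap s = #{i ∈ range k | off (q i) = s}
  cap_le : ∀ s, cap s ≤ m
  mc_lt : ∀ i < k, mc (q i) < cap (off (q i))
  mc_ne : ∀ i' < k, ∀ i < i', off (q i) = off (q i') → mc (q i) ≠ mc (q i')
  fl_gt : ∀ i < k, off (q i) < fl (par (q i))
  of_lt_fl : ∀ p s, s < fl p → ∃ i < k, par (q i) = p ∧ s ≤ off (q i)
  prec : ∀ i' < k, ∀ i < i', par (q i) = q i' + 1 → off (q i) < off (q i')
  greedy : ∀ i < k, ∀ s < off (q i), #{i' ∈ range i | off (q i') = s} = m ∨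
    ∃ i' < i, par (q i') = q i + 1 ∧ s ≤ off (q i')
  le_T : ∀ i < k, off (q i) + key (q i) ≤ T
  T_eq : T = 0 ∨ ∃ i < k, T = off (q i) + key (q i)

namespace Placed

variable {m : ℕ} {q par key : ℕ → ℕ} {k : ℕ} {off mc cap fl : ℕ → ℕ} {T : ℕ}

theorem init (hcap : ∀ s, cap s = 0) (hfl : ∀ p, fl p = 0) :
    Placed m q par key 0 off mc cap fl 0 := by
  constructor <;> simp [hcap, hfl]

theorem step {off' mc' cap' fl' : ℕ → ℕ} {T' o : ℕ}
    (h : Placed m q par key k off mc cap fl T) (hq : ∀ i < k, q i ≠ q k)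
    (ho : fl (q k + 1) ≤ o) (hom : cap o < m) (hfull : ∀ s, fl (q k + 1) ≤ s → s < o → cap s = m)
    (hoff : ∀ j, off' j = if j = q k then o else off j)
    (hmc : ∀ j, mc' j = if j = q k then cap o else mc j)
    (hcap : ∀ s, cap' s = if s = o then cap o + 1 else cap s)
    (hfl : ∀ p, fl' p = if p = par (q k) then max (fl p) (o + 1) else fl p)
    (hT : T' = max T (o + key (q k))) :
    Placed m q par key (k + 1) off' mc' cap' fl' T' := by
  have hok : off' (q k) = o := by simp [hoff]
  have hoi : ∀ i < k, off' (q i) = off (q i) := fun i hi => by simp [hoff, hq i hi]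
  have hmk : mc' (q k) = cap o := by simp [hmc]
  have hmi : ∀ i < k, mc' (q i) = mc (q i) := fun i hi => by simp [hmc, hq i hi]
  have hcle : ∀ s, cap s ≤ cap' s := fun s => by rw [hcap]; split_ifs with hs <;> simp [hs]
  have hfle : ∀ p, fl p ≤ fl' p := fun p => by rw [hfl]; split_ifs <;> simp
  have hcount : ∀ i ≤ k, ∀ s,
      #{i' ∈ range i | off' (q i') = s} = #{i' ∈ range i | off (q i') = s} := by
    intro i hi s
    congr 1
    refine filter_congr fun i' hi' => ?_
    rw [hoi i' ((mem_range.1 hi').trans_le hi)]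
  refine ⟨?_, ?_, ?_, ?_, ?_, ?_, ?_, ?_, ?_, ?_⟩
  · intro s
    rw [range_add_one, filter_insert, hok, hcap]
    by_cases hs : s = o
    · subst hs
      rw [if_pos rfl, if_pos rfl, card_insert_of_notMem (by simp), hcount k le_rfl, h.cap_eq]
    · rw [if_neg hs, if_neg (Ne.symm hs), hcount k le_rfl, h.cap_eq]
  · intro s
    rw [hcap]
    split_ifs
    exacts [hom, h.cap_le s]
  · intro i hi
    rcases Nat.lt_succ_iff_lt_or_eq.1 hi with hi | rfl
    · rw [hoi i hi, hmi i hi]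
      exact (h.mc_lt i hi).trans_le (hcle _)
    · rw [hok, hmk, hcap, if_pos rfl]
      exact Nat.lt_succ_self _
  · intro i' hi' i hi
    rcases Nat.lt_succ_iff_lt_or_eq.1 hi' with hi' | rfl
    · rw [hoi i (hi.trans hi'), hoi i' hi', hmi i (hi.trans hi'), hmi i' hi']
      exact h.mc_ne i' hi' i hi
    · rw [hoi i hi, hmi i hi, hok, hmk]
      rintro rfl
      exact (h.mc_lt i hi).ne
  · intro i hi
    rcases Nat.lt_succ_iff_lt_or_eq.1 hi with hi | rfl
    · rw [hoi i hi]
      exact (h.fl_gt i hi).trans_le (hfle _)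
    · rw [hok, hfl, if_pos rfl]
      exact Nat.lt_of_succ_le (le_max_right _ _)
  · intro p s hs
    have old : s < fl p → ∃ i < k + 1, par (q i) = p ∧ s ≤ off' (q i) := by
      intro hs
      obtain ⟨i, hi, h1, h2⟩ := h.of_lt_fl p s hs
      exact ⟨i, by omega, h1, by rwa [hoi i hi]⟩
    rw [hfl] at hs
    split_ifs at hs with hp
    · rcases lt_max_iff.1 hs with hs | hs
      · exact old hs
      · exact ⟨k, by omega, hp.symm, by rw [hok]; omega⟩
    · exact old hs
  · intro i' hi' i hi hp
    rcases Nat.lt_succ_iff_lt_or_eq.1 hi' with hi' | rfl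
    · rw [hoi i (hi.trans hi'), hoi i' hi']
      exact h.prec i' hi' i hi hp
    · rw [hoi i hi, hok]
      have := h.fl_gt i hi
      rw [hp] at this
      exact this.trans_le ho
  · intro i hi s hs
    rcases Nat.lt_succ_iff_lt_or_eq.1 hi with hi | rfl
    · rw [hoi i hi] at hs
      rw [hcount i hi.le]
      refine (h.greedy i hi s hs).imp_right ?_
      rintro ⟨i', h1, h2, h3⟩
      exact ⟨i', h1, h2, by rwa [hoi i' (h1.trans hi)]⟩
    · rw [hok] at hs
      rw [hcount i le_rfl, ← h.cap_eq]
      rcases lt_or_ge s (fl (q i + 1)) with hs' | hs'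
      · obtain ⟨i', h1, h2, h3⟩ := h.of_lt_fl _ s hs'
        exact .inr ⟨i', h1, h2, by rwa [hoi i' h1]⟩
      · exact .inl (hfull s hs' hs)
  · intro i hi
    rcases Nat.lt_succ_iff_lt_or_eq.1 hi with hi | rfl
    · rw [hoi i hi, hT]
      exact (h.le_T i hi).trans (le_max_left _ _)
    · rw [hok, hT]
      exact le_max_right _ _
  · right
    by_cases hTT : T ≤ o + key (q k)
    · exact ⟨k, by omega, by rw [hok, hT, max_eq_right hTT]⟩
    · rcases h.T_eq with h0 | ⟨i, hi, h1⟩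
      · omega
      · exact ⟨i, by omega, by rw [hoi i hi, hT, max_eq_left (by omega), h1]⟩

/-- Among `n > k` consecutive slots, one is not full. -/
theorem exists_lt (h : Placed m q par key k off mc cap fl T) {n o : ℕ} (hk : k < n) (hm : 0 < m) :
    ∃ s, o ≤ s ∧ s < o + n ∧ cap s < m := by
  by_contra! hc
  have h1 : ∑ s ∈ Ico o (o + n), cap s ≤ k := by
    simp only [h.cap_eq]
    rw [sum_card_fiberwise_eq_card_filter]
    simpa using card_filter_le (range k) fun i => off (q i) ∈ Ico o (o + n)
  have h2 : ∑ s ∈ Ico o (o + n), 1 ≤ ∑ s ∈ Ico o (o + n), cap s :=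
    sum_le_sum fun s hs => by
      rw [mem_Ico] at hs
      exact hm.trans_le (hc s hs.1 hs.2)
  simp at h2
  omega

end Placed

/-! ### Optimality -/

namespace Data

variable {D : Data} {un key par ord sel off mc cap fl : ℕ → ℕ} {T : ℕ}

/-- In a feasible schedule that ends by time `M`, at most `m * (d + 1)` jobs start at or after
`M - 1 - d`. -/
theorem Feas.card_le {st : ℕ → ℝ} {mc : ℕ → ℕ} (hF : D.Feas st mc) {key q : ℕ → ℕ} {M : ℕ}
    (hkey : ∀ j < D.n, (key j : ℝ) ≤ st j) (hM : ∀ j < D.n, ⌊st j⌋₊ + 1 ≤ M)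
    (hq : ∀ i < D.n, q i < D.n) (hinj : ∀ i < D.n, ∀ i' < D.n, q i = q i' → i = i') (d : ℕ) :
    #{i ∈ range D.n | M - 1 - key (q i) ≤ d} ≤ D.m * (d + 1) := by
  have h0 : ∀ j < D.n, 0 ≤ st j := fun j hj => (Nat.cast_nonneg _).trans (hF.release j hj)
  have hmaps : Set.MapsTo (fun i => (mc (q i), M - 1 - ⌊st (q i)⌋₊))
      ({i ∈ range D.n | M - 1 - key (q i) ≤ d} : Finset ℕ)
      (range D.m ×ˢ range (d + 1) : Finset (ℕ × ℕ)) := by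
    intro i hi
    simp only [coe_filter, mem_range, Set.mem_ofPred_eq] at hi
    have h1 := hF.lt _ (hq i hi.1)
    have h2 : key (q i) ≤ ⌊st (q i)⌋₊ := Nat.le_floor (hkey _ (hq i hi.1))
    simp only [coe_product, coe_range, Set.mem_prod, Set.mem_Iio]
    exact ⟨h1, by omega⟩
  have hinj' : Set.InjOn (fun i => (mc (q i), M - 1 - ⌊st (q i)⌋₊))
      ({i ∈ range D.n | M - 1 - key (q i) ≤ d} : Finset ℕ) := by
    intro i hi i' hi' he
    simp only [coe_filter, mem_range, Set.mem_ofPred_eq] at hi hi'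
    simp only [Prod.mk.injEq] at he
    have hi1 := hq i hi.1
    have hi2 := hq i' hi'.1
    have hfl : ⌊st (q i)⌋₊ = ⌊st (q i')⌋₊ := by
      have := hM _ hi1
      have := hM _ hi2
      omega
    refine hinj i hi.1 i' hi'.1 ?_
    by_contra hne
    rcases hF.disjoint _ hi1 _ hi2 hne he.1 with h | h
    · have := Nat.floor_le_floor h
      rw [Nat.floor_add_one (h0 _ hi1)] at this
      omega
    · have := Nat.floor_le_floor h
      rw [Nat.floor_add_one (h0 _ hi2)] at this
      omega
  simpa using card_le_card_of_injOn _ hmaps hinj'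

theorem Reach.pos_lt (h : Reach D D.n un key par ord sel) {i i' : ℕ} (hi : i < D.n)
    (hlt : key (ord i) < key (ord i')) : i < i' := by
  by_contra! hc
  exact absurd (h.sorted i hi i' hc) (not_le.2 hlt)

/-- Jobs placed in the order of nonincreasing keys, each in a slot before all of its children: with
slot `o` taking place at time `T - o`, the schedule is feasible. -/
theorem Reach.feas (hV : D.Valid) (h : Reach D D.n un key par ord sel)
    (hp : Placed D.m (fun i => ord (D.n - (i + 1))) par key D.n off mc cap fl T) :
    D.Feas (fun j => ((T - off j : ℕ) : ℝ)) mc := by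
  have hq : ∀ j < D.n, ∃ i < D.n, ord (D.n - (i + 1)) = j := by
    intro j hj
    obtain ⟨i, hi, rfl⟩ := h.exists_ord hj
    exact ⟨D.n - (i + 1), by omega, congrArg ord (by omega)⟩
  have hT : ∀ j < D.n, off j + key j ≤ T := by
    intro j hj
    obtain ⟨i, hi, rfl⟩ := hq j hj
    exact hp.le_T i hi
  refine ⟨fun j hj => ?_, fun i hi j hj hne hm => ?_, fun j hj => ?_, fun j hj hpred => ?_⟩
  · obtain ⟨i, hi, rfl⟩ := hq j hj
    exact (hp.mc_lt i hi).trans_le (hp.cap_le _)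
  · have hoff : off i ≠ off j := by
      obtain ⟨x, hx, rfl⟩ := hq i hi
      obtain ⟨y, hy, rfl⟩ := hq j hj
      intro he
      rcases lt_trichotomy x y with hxy | rfl | hxy
      · exact hp.mc_ne y hy x hxy he hm
      · exact hne rfl
      · exact hp.mc_ne x hx y hxy he.symm hm.symm
    have h1 := hT i hi
    have h2 := hT j hj
    rcases hoff.lt_or_gt with hlt | hlt
    · right
      exact_mod_cast (by omega : T - off j + 1 ≤ T - off i)
    · left
      exact_mod_cast (by omega : T - off i + 1 ≤ T - off j)
  · have h1 := hT j hj
    have h2 := h.rel_le_key hj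
    exact_mod_cast (by omega : D.rel j ≤ T - off j)
  · obtain ⟨p, hpar⟩ := h.exists_par hj hpred
    obtain ⟨harc, hkey⟩ := h.key_par hj hpar
    refine ⟨p, harc, ?_⟩
    have hpn := (hV p j harc).1
    have h1 := hT p hpn
    have hlt : off j < off p := by
      obtain ⟨x, hx, rfl⟩ := hq j hj
      obtain ⟨y, hy, rfl⟩ := hq p hpn
      have := h.pos_lt (by omega) (Nat.lt_of_succ_le hkey)
      exact hp.prec y hy x (by omega) hpar
    exact_mod_cast (by omega : T - off p + 1 ≤ T - off j)

/-- The schedule ends no later than any feasible schedule. -/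
theorem Reach.optimal (hV : D.Valid) (h : Reach D D.n un key par ord sel)
    (hp : Placed D.m (fun i => ord (D.n - (i + 1))) par key D.n off mc cap fl T) {st : ℕ → ℝ}
    {mc' : ℕ → ℕ} (hF : D.Feas st mc') {c : ℝ} (hc : ∀ j < D.n, st j + 1 ≤ c) {j : ℕ}
    (hj : j < D.n) : ((T - off j : ℕ) : ℝ) + 1 ≤ c := by
  have h0 : ∀ j < D.n, 0 ≤ st j := fun j hj => (Nat.cast_nonneg _).trans (hF.release j hj)
  have hks : ∀ j < D.n, (key j : ℝ) ≤ st j := fun j hj => h.key_le_start hV hF hj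
  have hM : ∀ j < D.n, ⌊st j⌋₊ + 1 ≤ ⌊c⌋₊ := by
    intro j hj
    rw [← Nat.floor_add_one (h0 j hj)]
    exact Nat.floor_le_floor (hc j hj)
  have hkM : ∀ j < D.n, key j + 1 ≤ ⌊c⌋₊ := fun j hj => by
    have := Nat.le_floor (hks j hj)
    have := hM j hj
    omega
  have hqn : ∀ i < D.n, ord (D.n - (i + 1)) < D.n := fun i hi => h.ord_lt _ (by omega)
  have hle : ∀ i < D.n, off (ord (D.n - (i + 1))) ≤ ⌊c⌋₊ - 1 - key (ord (D.n - (i + 1))) := by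
    refine greedy_le_deadline (m := D.m) (P := fun i i' => i < D.n ∧ i' < D.n ∧
      par (ord (D.n - (i + 1))) = ord (D.n - (i' + 1)) + 1) ?_ ?_ ?_ ?_ ?_ ?_
    · rintro i a b ⟨-, ha, ha'⟩ ⟨-, hb, hb'⟩
      have := h.inj (D.n - (a + 1)) (by omega) (D.n - (b + 1)) (by omega) (by omega)
      omega
    · rintro i a ⟨hi, ha, hia⟩
      have h1 := (h.key_par (hqn i hi) hia).2
      have h2 := hkM _ (hqn i hi)
      omega
    · intro i' hi' i hi
      have := h.sorted (D.n - (i + 1)) (by omega) (D.n - (i' + 1)) (by omega)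
      omega
    · exact hF.card_le hks hM hqn fun i hi i' hi' he => by
        have := h.inj _ (by omega) _ (by omega) he
        omega
    · intro i hi s
      refine le_trans (card_le_card (filter_subset_filter _ (range_mono hi.le))) ?_
      exact (hp.cap_eq s).symm.trans_le (hp.cap_le s)
    · intro i hi s hs
      refine (hp.greedy i hi s hs).imp_right ?_
      rintro ⟨i', h1, h2, h3⟩
      exact ⟨i', h1, ⟨h1.trans hi, hi, h2⟩, h3⟩
  have hpos := hkM j hj
  have hT : T + 1 ≤ ⌊c⌋₊ := by
    rcases hp.T_eq with h1 | ⟨i, hi, h1⟩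
    · omega
    · have h2 := hle i hi
      have h3 := hkM _ (hqn i hi)
      rw [h1]
      omega
  have h1 : T - off j + 1 ≤ ⌊c⌋₊ := by omega
  exact_mod_cast (Nat.le_floor_iff' (by omega)).1 h1

end Data

end OrSched

/-! ### The program -/

/-!
Variables: `1`, `2` and `3` hold the numbers of jobs, arcs and machines, `5` and `6` are the indices
of inner and outer loops, `7` is the current job, `8` flags infeasibility, `10` is the current slot,
and `11` is the start time of slot `0`. Bank `0` is the input, and the other banks are the arrays
named by the abbreviations below. Truncated subtraction serves as comparison, and `x + (y - x)` is
the maximum of `x` and `y`.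
-/

namespace OrSched

namespace Program

open RAM

/-- The number of jobs. -/
abbrev nJobs : Ex := .var 1

/-- The number of machines. -/
abbrev nMachines : Ex := .var 3

/-- The tail of the arc whose number is the inner loop index. -/
abbrev tail : Ex := .cell 0 (3 + nJobs + nJobs + .var 5 + .var 5)

/-- The head of the arc whose number is the inner loop index. -/
abbrev head : Ex := .cell 0 (3 + nJobs + nJobs + .var 5 + .var 5 + 1)

/-- Nonzero if the job `j` is not yet reached. -/
abbrev unE (j : Ex) : Ex := .cell 1 j

/-- The earliest start time of `j`. -/
abbrev keyE (j : Ex) : Ex := .cell 2 j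

/-- The parent of `j`, plus one. -/
abbrev parE (j : Ex) : Ex := .cell 3 j

/-- The job selected in round `i`. -/
abbrev ordE (i : Ex) : Ex := .cell 4 i

/-- The slot of `j`, counted backwards from the end of the schedule. -/
abbrev offE (j : Ex) : Ex := .cell 5 j

/-- The machine of `j`. -/
abbrev mcE (j : Ex) : Ex := .cell 6 j

/-- The number of jobs in slot `s`. -/
abbrev capE (s : Ex) : Ex := .cell 7 s

/-- The first slot after those of the children of the job `p - 1`. -/
abbrev flE (p : Ex) : Ex := .cell 8 p

/-- Nonzero if the job `j` is selected. -/
abbrev selE (j : Ex) : Ex := .cell 9 j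

/-- Mark the jobs with predecessors as unreached. -/
def markHeads : Cmd := .loop 5 2 (.put 1 head 1)

/-- Copy the release dates into the keys. -/
def readKeys : Cmd := .loop 5 1 (.put 2 (.var 5) (.cell 0 (3 + .var 5)))

/-- Set variable 7 to `j + 1` for a reached unselected job `j` with minimal key. -/
def selectMin : Cmd :=
  .loop 5 1 (.ite (unE (.var 5) + selE (.var 5)) .skip
    (.ite (.var 7)
      (.ite (keyE (.var 7 - 1) - keyE (.var 5)) (.set 7 (.var 5 + 1)) .skip)
      (.set 7 (.var 5 + 1))))

/-- Reach the unreached successors of the job in variable 7. -/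
def relax : Cmd :=
  .loop 5 2 (.ite ((tail - .var 7) + (.var 7 - tail)) .skip
    (.ite (unE head)
      (.put 2 head (keyE head + ((keyE (.var 7) + 1) - keyE head)) ;;
        .put 3 head (.var 7 + 1) ;; .put 1 head 0)
      .skip))

/-- One round of the search. Variable 8 becomes nonzero if the instance is infeasible. -/
def searchRound : Cmd :=
  -- without machines, already one job makes the instance infeasible
  .set 8 (.var 8 + (1 - nMachines)) ;; .set 7 0 ;; selectMin ;;
    .ite (.var 7)
      (.set 7 (.var 7 - 1) ;; .put 4 (.var 6) (.var 7) ;; .put 9 (.var 7) 1 ;; relax)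
      (.set 8 1)

/-- Dijkstra's algorithm. -/
def search : Cmd := .loop 6 1 searchRound

/-- Increase variable 10 to the next slot that is not full. -/
def findSlot : Cmd :=
  .loop 5 1 (.ite (nMachines - capE (.var 10)) .skip (.set 10 (.var 10 + 1)))

/-- Place one job; variable 11 is the latest start time needed so far. -/
def placeRound : Cmd :=
  .set 7 (ordE (nJobs - (.var 6 + 1))) ;; .set 10 (flE (.var 7 + 1)) ;; findSlot ;;
    .put 5 (.var 7) (.var 10) ;; .put 6 (.var 7) (capE (.var 10)) ;;
    .put 7 (.var 10) (capE (.var 10) + 1) ;;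
    .put 8 (parE (.var 7)) (flE (parE (.var 7)) + ((.var 10 + 1) - flE (parE (.var 7)))) ;;
    .set 11 (.var 11 + ((.var 10 + keyE (.var 7)) - .var 11))

/-- Place the jobs in the reverse of the order of selection. -/
def place : Cmd := .loop 6 1 placeRound

/-- Write the schedule. -/
def printSchedule : Cmd :=
  .out 1 ;; .loop 5 1 (.out (.var 11 - offE (.var 5))) ;; .loop 5 1 (.out (mcE (.var 5)))

/-- The algorithm, once the numbers of jobs and arcs are in the variables 1 and 2. -/
def main : Cmd :=
  .set 3 (.cell 0 1) ;; markHeads ;; readKeys ;; search ;;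
    .ite (.var 8) (.out 0) (place ;; printSchedule)

/-! ### Correctness of the program -/

/-- The state `σ` holds the data `D`. -/
structure Reads (D : Data) (σ : State) : Prop where
  n : σ.reg 1 = D.n
  a : σ.reg 2 = D.a
  m : σ.reg 3 = D.m
  rel : ∀ j, σ.mem 0 (3 + j) = D.rel j
  tl : ∀ e, σ.mem 0 (3 + D.n + D.n + e + e) = D.tl e
  hd : ∀ e, σ.mem 0 (3 + D.n + D.n + e + e + 1) = D.hd e

variable {D : Data} {σ : State}

theorem Reads.frame {c : Cmd} {τ : State} (h : Reads D σ) (hF : c.Frame σ τ)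
    (hc : ∀ r ∈ [1, 2, 3], r ∉ c.writes) (h0 : 0 ∉ c.banks) : Reads D τ := by
  obtain ⟨h1, h2, h3, h4, h5, h6⟩ := h
  have e1 := hF.reg 1 (hc 1 (by decide))
  have e2 := hF.reg 2 (hc 2 (by decide))
  have e3 := hF.reg 3 (hc 3 (by decide))
  have e4 := hF.mem 0 h0
  exact ⟨e1.trans h1, e2.trans h2, e3.trans h3, by rwa [e4], by rwa [e4], by rwa [e4]⟩

theorem Reads.eval_head (h : Reads D σ) : head.eval σ = D.hd (σ.reg 5) := by
  simp [h.n, h.hd]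

theorem Reads.setReg (h : Reads D σ) (v : ℕ) : Reads D (σ.setReg 5 v) :=
  ⟨h.n, h.a, h.m, h.rel, h.tl, h.hd⟩

theorem markHeads_spec (h : Reads D σ) (h1 : ∀ j, σ.mem 1 j = 0) (j : ℕ) :
    (markHeads.run σ).mem 1 j ≠ 0 ↔ ∃ e < D.a, D.hd e = j := by
  have key := Cmd.loop_induction (i := 5) (b := 2) (c := .put 1 head 1) (σ := σ)
    (fun k τ => ∀ j, τ.mem 1 j ≠ 0 ↔ ∃ e < k, D.hd e = j) (by simp [h1]) ?_
  · rw [h.a] at key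
    exact key j
  · intro k _ τ hF ih j
    have hR := (h.frame hF (by decide) (by decide)).setReg k
    simp only [Cmd.run, State.setMem_mem, if_true, hR.eval_head, Ex.eval_ofNat, State.setReg_reg,
      State.setReg_mem, Function.update_apply, Nat.lt_succ_iff_lt_or_eq]
    split_ifs with hj
    · simpa using Or.inr hj.symm
    · rw [ih]
      constructor
      · rintro ⟨e, he, h'⟩; exact ⟨e, .inl he, h'⟩
      · rintro ⟨e, he | rfl, h'⟩
        exacts [⟨e, he, h'⟩, absurd h'.symm hj]

theorem readKeys_spec (h : Reads D σ) (j : ℕ) (hj : j < D.n) :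
    (readKeys.run σ).mem 2 j = D.rel j := by
  have key := Cmd.loop_induction (i := 5) (b := 1) (c := .put 2 (.var 5) (.cell 0 (3 + .var 5)))
    (σ := σ) (fun k τ => ∀ j < k, τ.mem 2 j = D.rel j) (by simp) ?_
  · rw [h.n] at key
    exact key j hj
  · intro k _ τ hF ih j hj
    have hR := h.frame hF (by decide) (by decide)
    simp only [Cmd.run, State.setMem_mem, if_true, Ex.eval_cell, Ex.eval_add, Ex.eval_var,
      Ex.eval_ofNat, State.setReg_reg, State.setReg_mem, Function.update_apply, hR.rel]
    split_ifs with hjk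
    · rw [hjk]
    · exact ih j (by omega)

theorem selectMin_spec (h : Reads D σ) (h7 : σ.reg 7 = 0) :
    ((selectMin.run σ).reg 7 = 0 ∧ ∀ j < D.n, σ.mem 1 j = 0 → σ.mem 9 j ≠ 0) ∨
    ∃ b < D.n, (selectMin.run σ).reg 7 = b + 1 ∧ σ.mem 1 b = 0 ∧ σ.mem 9 b = 0 ∧
      ∀ j < D.n, σ.mem 1 j = 0 → σ.mem 9 j = 0 → σ.mem 2 b ≤ σ.mem 2 j := by
  rw [← h.n]
  refine Cmd.loop_induction (fun k τ =>
    (τ.reg 7 = 0 ∧ ∀ j < k, σ.mem 1 j = 0 → σ.mem 9 j ≠ 0) ∨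
    ∃ b < k, τ.reg 7 = b + 1 ∧ σ.mem 1 b = 0 ∧ σ.mem 9 b = 0 ∧
      ∀ j < k, σ.mem 1 j = 0 → σ.mem 9 j = 0 → σ.mem 2 b ≤ σ.mem 2 j) (by simp [h7]) ?_
  intro k _ τ hF ih
  have m1 := hF.mem 1 (by decide)
  have m2 := hF.mem 2 (by decide)
  have m9 := hF.mem 9 (by decide)
  simp only [Cmd.run, Ex.eval_add, Ex.eval_sub, Ex.eval_cell, Ex.eval_var, State.setReg_reg,
    State.setReg_mem, if_true, Ex.eval_ofNat, m1, m2, m9, Nat.reduceEqDiff, if_false,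
    Nat.lt_succ_iff_lt_or_eq]
  split_ifs with c1 c2 c3
  · have c1' : σ.mem 1 k = 0 → σ.mem 9 k ≠ 0 := by omega
    rcases ih with ⟨i1, i2⟩ | ⟨b, hb, i1, i2, i3, i4⟩
    · refine .inl ⟨by simpa using i1, ?_⟩
      rintro j (hj | rfl)
      exacts [i2 j hj, c1']
    · refine .inr ⟨b, .inl hb, by simpa using i1, i2, i3, ?_⟩
      rintro j (hj | rfl) u s
      exacts [i4 j hj u s, absurd s (c1' u)]
  · rcases ih with ⟨i1, i2⟩ | ⟨b, hb, i1, i2, i3, i4⟩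
    · exact absurd i1 c2
    · rw [i1, Nat.add_sub_cancel] at c3
      refine .inr ⟨k, .inr rfl, by simp, by omega, by omega, ?_⟩
      rintro j (hj | rfl) u s
      · have := i4 j hj u s
        omega
      · exact le_rfl
  · rcases ih with ⟨i1, i2⟩ | ⟨b, hb, i1, i2, i3, i4⟩
    · exact absurd i1 c2
    · rw [i1, Nat.add_sub_cancel] at c3
      refine .inr ⟨b, .inl hb, by simpa using i1, i2, i3, ?_⟩
      rintro j (hj | rfl) u s
      · exact i4 j hj u s
      · omega
  · rcases ih with ⟨i1, i2⟩ | ⟨b, hb, i1, i2, i3, i4⟩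
    · refine .inr ⟨k, .inr rfl, by simp, by omega, by omega, ?_⟩
      rintro j (hj | rfl) u s
      exacts [absurd s (i2 j hj u), le_rfl]
    · omega

theorem relax_spec (h : Reads D σ) (hb : σ.mem 1 (σ.reg 7) = 0) (j : ℕ) :
    (σ.mem 1 j ≠ 0 → D.Arc (σ.reg 7) j → (relax.run σ).mem 1 j = 0 ∧
      (relax.run σ).mem 2 j = max (σ.mem 2 j) (σ.mem 2 (σ.reg 7) + 1) ∧
      (relax.run σ).mem 3 j = σ.reg 7 + 1) ∧
    (¬ (σ.mem 1 j ≠ 0 ∧ D.Arc (σ.reg 7) j) → (relax.run σ).mem 1 j = σ.mem 1 j ∧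
      (relax.run σ).mem 2 j = σ.mem 2 j ∧ (relax.run σ).mem 3 j = σ.mem 3 j) := by
  revert j
  simp only [Data.Arc]
  rw [← h.a]
  refine Cmd.loop_induction (fun k τ => ∀ j,
    (σ.mem 1 j ≠ 0 → (∃ e < k, D.tl e = σ.reg 7 ∧ D.hd e = j) → τ.mem 1 j = 0 ∧
      τ.mem 2 j = max (σ.mem 2 j) (σ.mem 2 (σ.reg 7) + 1) ∧ τ.mem 3 j = σ.reg 7 + 1) ∧
    (¬ (σ.mem 1 j ≠ 0 ∧ ∃ e < k, D.tl e = σ.reg 7 ∧ D.hd e = j) → τ.mem 1 j = σ.mem 1 j ∧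
      τ.mem 2 j = σ.mem 2 j ∧ τ.mem 3 j = σ.mem 3 j)) (by simp) ?_
  intro k _ τ hF ih
  have hR := h.frame hF (by decide) (by decide)
  have r7 := hF.reg 7 (by decide)
  have kb : τ.mem 2 (σ.reg 7) = σ.mem 2 (σ.reg 7) := ((ih (σ.reg 7)).2 (by simp [hb])).2.1
  have hE : ∀ j, (∃ e < k + 1, D.tl e = σ.reg 7 ∧ D.hd e = j) ↔
      (∃ e < k, D.tl e = σ.reg 7 ∧ D.hd e = j) ∨ (D.tl k = σ.reg 7 ∧ D.hd k = j) := by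
    intro j
    simp only [Nat.lt_succ_iff_lt_or_eq]
    constructor
    · rintro ⟨e, he | rfl, h'⟩
      exacts [.inl ⟨e, he, h'⟩, .inr h']
    · rintro (⟨e, he, h'⟩ | h')
      exacts [⟨e, .inl he, h'⟩, ⟨k, .inr rfl, h'⟩]
  simp only [hE]
  simp only [Cmd.run, Ex.eval_add, Ex.eval_sub, Ex.eval_cell, Ex.eval_var, State.setReg_reg,
    State.setReg_mem, if_true, Ex.eval_ofNat, Nat.reduceEqDiff, if_false, hR.n, hR.tl, hR.hd, r7]
  split_ifs with c1 c2
  · have c1' : D.tl k ≠ σ.reg 7 := by omega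
    simpa [c1'] using ih
  · have c1' : D.tl k = σ.reg 7 := by omega
    intro j
    obtain ⟨i1, i2⟩ := ih j
    simp only [State.setMem_mem, State.setMem_reg, State.setReg_mem, State.setReg_reg,
      Nat.reduceEqDiff, if_true, if_false, c1', hR.n, hR.hd, r7, kb, true_and,
      Function.update_apply]
    by_cases hj : j = D.hd k
    · subst hj
      have hnot : ¬ (σ.mem 1 (D.hd k) ≠ 0 ∧ ∃ e < k, D.tl e = σ.reg 7 ∧ D.hd e = D.hd k) :=
        fun hc => c2 (i1 hc.1 hc.2).1
      obtain ⟨g1, g2, g3⟩ := i2 hnot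
      rw [g1] at c2
      simp only [if_true, g2, true_and, and_true, or_true, c2, ne_eq, not_false_eq_true,
        not_true_eq_false, forall_const, false_imp_iff]
      omega
    · have hj' : ¬ D.hd k = j := fun h => hj h.symm
      simp only [hj, hj', if_false, or_false]
      exact ⟨i1, i2⟩
  · have c1' : D.tl k = σ.reg 7 := by omega
    have c2' : τ.mem 1 (D.hd k) = 0 := not_not.1 c2
    intro j
    obtain ⟨i1, i2⟩ := ih j
    by_cases hj : D.hd k = j
    · subst hj
      have hQ : σ.mem 1 (D.hd k) ≠ 0 → ∃ e < k, D.tl e = σ.reg 7 ∧ D.hd e = D.hd k := by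
        intro hu
        by_contra hQ
        exact hu ((i2 fun hc => hQ hc.2).1.symm.trans c2')
      exact ⟨fun hu _ => i1 hu (hQ hu), fun hc => i2 fun hc' => hc ⟨hc'.1, .inl hc'.2⟩⟩
    · simpa [hj] using ih j

/-- The invariant of the search: unless infeasibility has been detected, `k` jobs are selected. -/
structure SearchInv (D : Data) (k : ℕ) (σ : State) : Prop where
  bad : σ.reg 8 ≠ 0 → (0 < D.n ∧ D.m = 0) ∨ D.Stuck
  pos : σ.reg 8 = 0 → 0 < k → 0 < D.m
  reach : σ.reg 8 = 0 → D.Reach k (σ.mem 1) (σ.mem 2) (σ.mem 3) (σ.mem 4) (σ.mem 9)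

theorem searchRound_spec (hV : D.Valid) (h : Reads D σ) (hk : σ.reg 6 < D.n)
    (hI : SearchInv D (σ.reg 6) σ) : SearchInv D (σ.reg 6 + 1) (searchRound.run σ) := by
  set σ₁ := (selectMin.run ((σ.setReg 8 (σ.reg 8 + (1 - σ.reg 3))).setReg 7 0)) with hσ₁
  have hF := Cmd.run_frame selectMin ((σ.setReg 8 (σ.reg 8 + (1 - σ.reg 3))).setReg 7 0)
  rw [← hσ₁] at hF
  have hR₀ : Reads D ((σ.setReg 8 (σ.reg 8 + (1 - σ.reg 3))).setReg 7 0) :=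
    ⟨h.n, h.a, h.m, h.rel, h.tl, h.hd⟩
  have hR := hR₀.frame hF (by decide) (by decide)
  have hmem : ∀ k, σ₁.mem k = σ.mem k := fun k => hF.mem k (by simp [selectMin, Cmd.banks])
  have h8 : σ₁.reg 8 = σ.reg 8 + (1 - D.m) := by
    rw [hF.reg 8 (by decide)]; simp [h.m]
  have h6 : σ₁.reg 6 = σ.reg 6 := by rw [hF.reg 6 (by decide)]; simp
  have hbad : σ₁.reg 8 ≠ 0 → (0 < D.n ∧ D.m = 0) ∨ D.Stuck := by
    intro hb
    by_cases h0 : σ.reg 8 = 0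
    · exact .inl ⟨by omega, by omega⟩
    · exact hI.bad h0
  have hrun : searchRound.run σ = if σ₁.reg 7 ≠ 0 then
      relax.run (((σ₁.setReg 7 (σ₁.reg 7 - 1)).setMem 4 (σ.reg 6) (σ₁.reg 7 - 1)).setMem 9
        (σ₁.reg 7 - 1) 1) else σ₁.setReg 8 1 := by
    simp [searchRound, Cmd.run, ← hσ₁, h6]
  rw [hrun]
  rcases selectMin_spec hR₀ (by simp) with ⟨h7, hnone⟩ | ⟨b, hb, h7, hub, hsb, hmin⟩
  · rw [← hσ₁] at h7
    rw [if_neg (by simp [h7])]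
    refine ⟨fun _ => ?_, by simp, by simp⟩
    by_cases h0 : σ.reg 8 = 0
    · exact .inr ((hI.reach h0).stuck hV hk hnone)
    · exact hI.bad h0
  · simp only [State.setReg_mem] at hub hsb hmin
    rw [← hσ₁] at h7
    rw [if_pos (by simp [h7]), h7, Nat.add_sub_cancel]
    set σ₂ := (((σ₁.setReg 7 b).setMem 4 (σ.reg 6) b).setMem 9 b 1) with hσ₂
    have hR₂ : Reads D σ₂ := ⟨hR.n, hR.a, hR.m, hR.rel, hR.tl, hR.hd⟩
    have hF₂ := Cmd.run_frame relax σ₂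
    have e8 : (relax.run σ₂).reg 8 = σ.reg 8 + (1 - D.m) := by
      rw [hF₂.reg 8 (by decide), ← h8]; simp [hσ₂]
    have e7 : σ₂.reg 7 = b := by simp [hσ₂]
    have m1 : σ₂.mem 1 = σ.mem 1 := by simp [hσ₂, hmem]
    have m2 : σ₂.mem 2 = σ.mem 2 := by simp [hσ₂, hmem]
    have m3 : σ₂.mem 3 = σ.mem 3 := by simp [hσ₂, hmem]
    have hrel := relax_spec hR₂ (by rwa [e7, m1])
    rw [e7, m1, m2, m3] at hrel
    refine ⟨fun hb => hbad (by rwa [h8, ← e8]), fun h0 _ => by omega, fun h0 => ?_⟩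
    refine (hI.reach (by omega)).step hV hb hub hsb hmin (fun i => ?_) (fun j => ?_)
      (fun j => (hrel j).1) (fun j => (hrel j).2)
    · rw [hF₂.mem 4 (by decide)]
      simp [hσ₂, hmem, Function.update_apply]
    · rw [hF₂.mem 9 (by decide)]
      simp [hσ₂, hmem, Function.update_apply]

theorem search_spec (hV : D.Valid) (h : Reads D σ) (hI : SearchInv D 0 σ) :
    SearchInv D D.n (search.run σ) := by
  rw [← h.n]
  refine Cmd.loop_induction (fun k τ => SearchInv D k τ) hI ?_
  intro k hk τ hF ih
  have hR := h.frame hF (by decide) (by decide)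
  have hR' : Reads D (τ.setReg 6 k) := ⟨hR.n, hR.a, hR.m, hR.rel, hR.tl, hR.hd⟩
  rw [h.n] at hk
  have h6 : (τ.setReg 6 k).reg 6 = k := by simp
  have := searchRound_spec hV hR' (by rwa [h6])
  rw [h6] at this
  exact this ⟨by simpa using ih.bad, by simpa using ih.pos, by simpa using ih.reach⟩

theorem findSlot_spec (h : Reads D σ) (hs : ∃ s, σ.reg 10 ≤ s ∧ s < σ.reg 10 + D.n ∧
    σ.mem 7 s < D.m) :
    σ.reg 10 ≤ (findSlot.run σ).reg 10 ∧ σ.mem 7 ((findSlot.run σ).reg 10) < D.m ∧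
      ∀ s, σ.reg 10 ≤ s → s < (findSlot.run σ).reg 10 → D.m ≤ σ.mem 7 s := by
  have key := Cmd.loop_induction (i := 5) (b := 1)
    (c := .ite (nMachines - capE (.var 10)) .skip (.set 10 (.var 10 + 1))) (σ := σ)
    (fun k τ => σ.reg 10 ≤ τ.reg 10 ∧ (σ.mem 7 (τ.reg 10) < D.m ∨ τ.reg 10 = σ.reg 10 + k) ∧
      ∀ s, σ.reg 10 ≤ s → s < τ.reg 10 → D.m ≤ σ.mem 7 s) ?_ ?_
  · rw [h.n] at key
    refine ⟨key.1, ?_, key.2.2⟩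
    rcases key.2.1 with h1 | h1
    · exact h1
    · obtain ⟨s, h2, h3, h4⟩ := hs
      exact absurd (key.2.2 s h2 (h3.trans_eq h1.symm)) (not_le.2 h4)
  · exact ⟨le_rfl, .inr rfl, fun s h1 h2 => by omega⟩
  · rintro k _ τ hF ⟨i1, i2, i3⟩
    have hR := h.frame hF (by decide) (by decide)
    have m7 := hF.mem 7 (by decide)
    simp only [Cmd.run, Ex.eval_sub, Ex.eval_add, Ex.eval_cell, Ex.eval_var, Ex.eval_ofNat,
      State.setReg_reg, State.setReg_mem, Nat.reduceEqDiff, if_false, hR.m, m7]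
    split_ifs with hc
    · simp only [State.setReg_reg, Nat.reduceEqDiff, if_false]
      exact ⟨i1, .inl (by omega), i3⟩
    · simp only [State.setReg_reg, if_true]
      refine ⟨by omega, .inr (by omega), fun s h1 h2 => ?_⟩
      rcases Nat.lt_succ_iff_lt_or_eq.1 h2 with h2 | rfl
      · exact i3 s h1 h2
      · omega

theorem placeRound_spec (h : Reads D σ) (hm : 0 < D.m) (hk : σ.reg 6 < D.n)
    {q : ℕ → ℕ} (hq : ∀ i, σ.mem 4 (D.n - (i + 1)) = q i) (hinj : ∀ i < σ.reg 6, q i ≠ q (σ.reg 6))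
    (hI : Placed D.m q (σ.mem 3) (σ.mem 2) (σ.reg 6) (σ.mem 5) (σ.mem 6) (σ.mem 7) (σ.mem 8)
      (σ.reg 11)) :
    Placed D.m q (σ.mem 3) (σ.mem 2) (σ.reg 6 + 1) ((placeRound.run σ).mem 5)
      ((placeRound.run σ).mem 6) ((placeRound.run σ).mem 7) ((placeRound.run σ).mem 8)
      ((placeRound.run σ).reg 11) := by
  set j := q (σ.reg 6) with hj
  set σ₀ := (σ.setReg 7 j).setReg 10 (σ.mem 8 (j + 1)) with hσ₀
  have hR₀ : Reads D σ₀ := ⟨h.n, h.a, h.m, h.rel, h.tl, h.hd⟩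
  have h10 : σ₀.reg 10 = σ.mem 8 (j + 1) := by simp [hσ₀]
  have hF := Cmd.run_frame findSlot σ₀
  have hspec := findSlot_spec hR₀ (hI.exists_lt hk hm)
  rw [h10] at hspec
  set σ₁ := findSlot.run σ₀ with hσ₁
  set o := σ₁.reg 10 with ho
  obtain ⟨s1, s2, s3⟩ := hspec
  have hmem : ∀ k, σ₁.mem k = σ.mem k := fun k => hF.mem k (by simp [findSlot, Cmd.banks])
  have h7 : σ₁.reg 7 = j := by rw [hF.reg 7 (by decide)]; simp [hσ₀]
  have h11 : σ₁.reg 11 = σ.reg 11 := by rw [hF.reg 11 (by decide)]; simp [hσ₀]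
  have hrun : placeRound.run σ = ((((σ₁.setMem 5 j o).setMem 6 j (σ.mem 7 o)).setMem 7 o
      (σ.mem 7 o + 1)).setMem 8 (σ.mem 3 j)
      (σ.mem 8 (σ.mem 3 j) + (o + 1 - σ.mem 8 (σ.mem 3 j)))).setReg 11
      (σ.reg 11 + (o + σ.mem 2 j - σ.reg 11)) := by
    have e1 : (Cmd.set 7 (ordE (nJobs - (.var 6 + 1)))).run σ = σ.setReg 7 j := by
      simp [Cmd.run, h.n, hq, hj]
    have e2 : (Cmd.set 10 (flE (.var 7 + 1))).run (σ.setReg 7 j) = σ₀ := by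
      simp [Cmd.run, hσ₀]
    rw [placeRound, Cmd.run, e1, Cmd.run, e2, Cmd.run, ← hσ₁]
    simp [Cmd.run, h7, h11, hmem, ← ho]
  rw [hrun]
  refine hI.step hinj s1 s2 (fun s h1 h2 => le_antisymm (hI.cap_le s) (s3 s h1 h2))
    (fun x => ?_) (fun x => ?_) (fun s => ?_) (fun p => ?_) ?_
  · simp [hmem, Function.update_apply, hj]
  · simp [hmem, Function.update_apply, hj]
  · simp [hmem, Function.update_apply]
  · simp only [State.setReg_mem, State.setMem_mem, Nat.reduceEqDiff, if_true, if_false, hmem,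
      Function.update_apply, ← hj]
    split_ifs with hp
    · subst hp; omega
    · rfl
  · simp only [State.setReg_reg, if_true, ← hj]
    omega

theorem place_spec (h : Reads D σ) (hm : 0 < D.n → 0 < D.m)
    (hr : D.Reach D.n (σ.mem 1) (σ.mem 2) (σ.mem 3) (σ.mem 4) (σ.mem 9))
    (h7 : ∀ s, σ.mem 7 s = 0) (h8 : ∀ s, σ.mem 8 s = 0) (h11 : σ.reg 11 = 0) :
    Placed D.m (fun i => σ.mem 4 (D.n - (i + 1))) (σ.mem 3) (σ.mem 2) D.n ((place.run σ).mem 5)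
      ((place.run σ).mem 6) ((place.run σ).mem 7) ((place.run σ).mem 8) ((place.run σ).reg 11) := by
  have key := Cmd.loop_induction (i := 6) (b := 1) (c := placeRound) (σ := σ)
    (fun k τ => Placed D.m (fun i => σ.mem 4 (D.n - (i + 1))) (σ.mem 3) (σ.mem 2) k
      (τ.mem 5) (τ.mem 6) (τ.mem 7) (τ.mem 8) (τ.reg 11))
    (by simpa [h11] using Placed.init h7 h8) ?_
  · rwa [h.n] at key
  · intro k hk τ hF ih
    have hR := h.frame hF (by decide) (by decide)
    have hR' : Reads D (τ.setReg 6 k) := ⟨hR.n, hR.a, hR.m, hR.rel, hR.tl, hR.hd⟩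
    rw [h.n] at hk
    have m2 := hF.mem 2 (by decide)
    have m3 := hF.mem 3 (by decide)
    have m4 := hF.mem 4 (by decide)
    have h6 : (τ.setReg 6 k).reg 6 = k := by simp
    have := placeRound_spec hR' (hm (by omega)) (by rwa [h6])
      (q := fun i => σ.mem 4 (D.n - (i + 1))) (fun i => by rw [State.setReg_mem, m4])
      (fun i hi he => by
        rw [h6] at hi he
        have := hr.inj _ (by omega) _ (by omega) he
        omega)
    rw [h6, State.setReg_mem, m2, m3] at this
    exact this (by simpa using ih)

/-- A loop that only writes: the hypothesis computes the expression when the loop index is `k`. -/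
theorem out_loop_spec (e : Ex) (g : ℕ → ℕ)
    (he : ∀ k, ∀ τ : State, τ.mem = σ.mem → (∀ r, r ≠ 5 → τ.reg r = σ.reg r) → τ.reg 5 = k →
      e.eval τ = g k) :
    ((Cmd.loop 5 1 (.out e)).run σ).out = σ.out ++ (List.range (σ.reg 1)).map g := by
  refine Cmd.loop_induction (fun k τ => τ.out = σ.out ++ (List.range k).map g) (by simp) ?_
  intro k _ τ hF ih
  have hk : e.eval (τ.setReg 5 k) = g k :=
    he k _ (funext fun b => hF.mem b (by simp [Cmd.banks]))
      (fun r hr => by simpa [hr] using hF.reg r (by simp [Cmd.writes, hr])) (by simp)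
  simp [Cmd.run, hk, ih, List.range_succ]

theorem printSchedule_spec (h : Reads D σ) : (printSchedule.run σ).out = σ.out ++ 1 ::
    ((List.range D.n).map (fun j => σ.reg 11 - σ.mem 5 j) ++ (List.range D.n).map (σ.mem 6)) := by
  set σ₁ : State := { σ with out := σ.out ++ [1] } with hσ₁
  have hF := Cmd.run_frame (.loop 5 1 (.out (.var 11 - offE (.var 5)))) σ₁
  have h1 := out_loop_spec (σ := σ₁) (.var 11 - offE (.var 5)) (fun j => σ.reg 11 - σ.mem 5 j)
    (fun k τ hm hr h5 => by simp [hm, h5, hr 11 (by decide), hσ₁])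
  have hm : ((Cmd.loop 5 1 (.out (.var 11 - offE (.var 5)))).run σ₁).mem 6 = σ.mem 6 :=
    hF.mem 6 (by decide)
  have hr : ((Cmd.loop 5 1 (.out (.var 11 - offE (.var 5)))).run σ₁).reg 1 = σ.reg 1 :=
    hF.reg 1 (by decide)
  have h2 := out_loop_spec (σ := (Cmd.loop 5 1 (.out (.var 11 - offE (.var 5)))).run σ₁)
    (mcE (.var 5)) (σ.mem 6) (fun k τ hm' hr h5 => by simp [hm', h5, hm])
  have e1 : printSchedule.run σ = (Cmd.loop 5 1 (.out (mcE (.var 5)))).run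
      ((Cmd.loop 5 1 (.out (.var 11 - offE (.var 5)))).run σ₁) := rfl
  rw [e1, h2, h1, hr]
  simp [hσ₁, h.n]

/-- The output is either `0`, and there is no feasible schedule, or a feasible schedule that ends no
later than any other. -/
theorem main_spec (hV : D.Valid) (h : Reads D (σ.setReg 3 (σ.mem 0 1)))
    (hmem : ∀ k ≠ 0, ∀ j, σ.mem k j = 0) (h8 : σ.reg 8 = 0) (h11 : σ.reg 11 = 0)
    (hout : σ.out = []) :
    ((main.run σ).out = [0] ∧ ∀ st mc, ¬ D.Feas st mc) ∨
    ∃ s mc : ℕ → ℕ, (main.run σ).out = 1 :: ((List.range D.n).map s ++ (List.range D.n).map mc) ∧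
      D.Feas (fun j => (s j : ℝ)) mc ∧ ∀ st mc', D.Feas st mc' → ∀ c : ℝ,
        (∀ j < D.n, st j + 1 ≤ c) → ∀ j < D.n, (s j : ℝ) + 1 ≤ c := by
  set σ₁ := σ.setReg 3 (σ.mem 0 1) with hσ₁
  set σ₂ := markHeads.run σ₁ with hσ₂
  set σ₃ := readKeys.run σ₂ with hσ₃
  set σ₄ := search.run σ₃ with hσ₄
  have F2 := Cmd.run_frame markHeads σ₁
  have F3 := Cmd.run_frame readKeys σ₂
  have F4 := Cmd.run_frame search σ₃
  rw [← hσ₂] at F2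
  rw [← hσ₃] at F3
  rw [← hσ₄] at F4
  have R2 := h.frame F2 (by decide) (by decide)
  have R3 := R2.frame F3 (by decide) (by decide)
  have R4 := R3.frame F4 (by decide) (by decide)
  have hmem₃ : ∀ k ≠ 0, k ≠ 1 → k ≠ 2 → ∀ j, σ₃.mem k j = 0 := by
    intro k h0 h1 h2 j
    rw [F3.mem k (by simp [readKeys, Cmd.banks, h2]), F2.mem k (by simp [markHeads, Cmd.banks, h1])]
    simp [hσ₁, hmem k h0]
  have h8₃ : σ₃.reg 8 = 0 := by
    rw [F3.reg 8 (by decide), F2.reg 8 (by decide)]; simp [hσ₁, h8]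
  have hI : SearchInv D 0 σ₃ := by
    refine ⟨fun hb => absurd h8₃ hb, by simp, fun _ =>
      Data.Reach.init (fun j => ?_) (fun j hj => ?_)
      (hmem₃ 3 (by decide) (by decide) (by decide)) (hmem₃ 9 (by decide) (by decide) (by decide))⟩
    · rw [F3.mem 1 (by decide)]
      exact markHeads_spec h (fun j => by simp [hσ₁, hmem 1]) j
    · exact readKeys_spec R2 j hj
  have hS := search_spec hV R3 hI
  rw [← hσ₄] at hS
  have hrun : main.run σ = if σ₄.reg 8 ≠ 0 then { σ₄ with out := σ₄.out ++ [0] } else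
      printSchedule.run (place.run σ₄) := rfl
  have hout₄ : σ₄.out = [] := by
    rw [F4.out (by decide), F3.out (by decide), F2.out (by decide)]; exact hout
  rw [hrun]
  by_cases hb : σ₄.reg 8 = 0
  · right
    rw [if_neg (by simp [hb])]
    have hr := hS.reach hb
    have hp := place_spec R4 (hS.pos hb) hr
      (by rw [F4.mem 7 (by decide)]; exact hmem₃ 7 (by decide) (by decide) (by decide))
      (by rw [F4.mem 8 (by decide)]; exact hmem₃ 8 (by decide) (by decide) (by decide))
      (by rw [F4.reg 11 (by decide), F3.reg 11 (by decide), F2.reg 11 (by decide)]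
          simp [hσ₁, h11])
    have F5 := Cmd.run_frame place σ₄
    have R5 := R4.frame F5 (by decide) (by decide)
    refine ⟨fun j => (place.run σ₄).reg 11 - (place.run σ₄).mem 5 j, (place.run σ₄).mem 6, ?_,
      hr.feas hV hp, fun st mc' hF c hc j hj => hr.optimal hV hp hF hc hj⟩
    rw [printSchedule_spec R5, F5.out (by decide), hout₄, List.nil_append]
  · left
    rw [if_pos hb]
    refine ⟨by simp [hout₄], fun st mc hF => ?_⟩
    rcases hS.bad hb with ⟨h1, h2⟩ | h1
    · have := hF.lt 0 h1
      omega
    · exact h1.not_feas hV st mc hF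

end Program

end OrSched

/-! ### From instances to inputs -/

namespace OrSched

open RAM

theorem getD_flatMap_arcs {n : ℕ} (l : List (Fin n × Fin n)) {e : ℕ} (he : e < l.length) :
    (l.flatMap fun a => [a.1.val, a.2.val]).getD (e + e) 0 = (l[e]).1.val ∧
      (l.flatMap fun a => [a.1.val, a.2.val]).getD (e + e + 1) 0 = (l[e]).2.val := by
  induction l generalizing e with
  | nil => simp at he
  | cons x l ih =>
    cases e with
    | zero => simp
    | succ e =>
      have := ih (e := e) (by simpa using he)
      rw [List.flatMap_cons, show e + 1 + (e + 1) = e + e + 1 + 1 by omega]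
      simpa using this

theorem length_flatMap_arcs {n : ℕ} (l : List (Fin n × Fin n)) :
    (l.flatMap fun a => [a.1.val, a.2.val]).length = l.length + l.length := by
  induction l with
  | nil => rfl
  | cons x l ih =>
    rw [List.flatMap_cons, List.length_append, ih]
    simp only [List.length_cons, List.length_nil]
    omega

namespace Instance

variable (I : Instance)

theorem length_encode : I.encode.length = 3 + I.n + I.n + (I.arcs.length + I.arcs.length) := by
  simp only [encode, List.length_append, length_flatMap_arcs, List.length_ofFn]
  simp

/-- The data of an instance, as the program reads them off the input. Beyond the jobs and arcs, the
values are whatever the input holds there. -/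
def toData : Data where
  n := I.n
  m := I.m
  a := I.arcs.length
  rel j := I.encode.getD (3 + j) 0
  tl e := I.encode.getD (3 + I.n + I.n + e + e) 0
  hd e := I.encode.getD (3 + I.n + I.n + e + e + 1) 0

variable {I}

theorem toData_rel (j : Fin I.n) : I.toData.rel j = I.release j := by
  have : I.encode = [I.n, I.m, I.arcs.length] ++ (List.ofFn I.release ++ (List.ofFn I.proc ++
    I.arcs.flatMap fun a => [a.1.val, a.2.val])) := by simp [encode]
  simp only [toData, this]
  rw [List.getD_append_right _ _ _ _ (by simp), List.getD_append _ _ _ _ (by simp)]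
  simp

theorem getD_encode_add (x : ℕ) : I.encode.getD (3 + I.n + I.n + x) 0 =
    (I.arcs.flatMap fun a => [a.1.val, a.2.val]).getD x 0 := by
  have hl : ([I.n, I.m, I.arcs.length] ++ List.ofFn I.release ++ List.ofFn I.proc).length =
      3 + I.n + I.n := by
    simp only [List.length_append, List.length_ofFn]
    simp
  rw [encode, List.getD_append_right _ _ _ _ (by rw [hl]; omega), hl, Nat.add_sub_cancel_left]

theorem toData_tl {e : ℕ} (he : e < I.arcs.length) : I.toData.tl e = (I.arcs[e]).1.val := by
  rw [← (getD_flatMap_arcs I.arcs he).1, ← getD_encode_add]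
  simp only [toData, add_assoc]

theorem toData_hd {e : ℕ} (he : e < I.arcs.length) : I.toData.hd e = (I.arcs[e]).2.val := by
  rw [← (getD_flatMap_arcs I.arcs he).2, ← getD_encode_add]
  simp only [toData, add_assoc]

theorem toData_arc {i j : ℕ} :
    I.toData.Arc i j ↔ ∃ (hi : i < I.n) (hj : j < I.n), (⟨i, hi⟩, ⟨j, hj⟩) ∈ I.arcs := by
  constructor
  · rintro ⟨e, he, rfl, rfl⟩
    rw [toData_tl he, toData_hd he]
    exact ⟨Fin.is_lt _, Fin.is_lt _, List.getElem_mem he⟩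
  · rintro ⟨hi, hj, h⟩
    obtain ⟨e, he, h'⟩ := List.getElem_of_mem h
    exact ⟨e, he, by rw [toData_tl he, h'], by rw [toData_hd he, h']⟩

theorem toData_valid : I.toData.Valid := fun _ _ h =>
  let ⟨hi, hj, _⟩ := toData_arc.1 h
  ⟨hi, hj⟩

theorem toData_arc_fin {i j : Fin I.n} : I.toData.Arc i j ↔ i ∈ I.pred j := by
  rw [toData_arc]
  exact ⟨fun ⟨_, _, h⟩ => h, fun h => ⟨i.2, j.2, h⟩⟩

theorem Schedule.Feasible.toData (hI : ∀ j, I.proc j = 1) {S : I.Schedule} (h : S.Feasible) :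
    I.toData.Feas (fun j => if hj : j < I.n then S.start ⟨j, hj⟩ else 0)
      (fun j => if hj : j < I.n then (S.machine ⟨j, hj⟩).val else 0) := by
  have hc : ∀ j, S.completion j = S.start j + 1 := fun j => by simp [completion, hI]
  refine ⟨fun j (hj : j < I.n) => ?_, fun i (hi : i < I.n) j (hj : j < I.n) hne hm => ?_,
    fun j (hj : j < I.n) => ?_, fun j (hj : j < I.n) hp => ?_⟩
  · simp only [hj, dif_pos]
    exact Fin.is_lt _
  · simp only [hi, hj, dif_pos] at hm ⊢
    simpa only [hc] using h.disjoint ⟨i, hi⟩ ⟨j, hj⟩ (by simpa using hne) (Fin.ext hm)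
  · simp only [hj, dif_pos]
    rw [toData_rel ⟨j, hj⟩]
    exact h.release_le _
  · obtain ⟨p, hp⟩ := hp
    obtain ⟨hpn, _, hmem⟩ := toData_arc.1 hp
    obtain ⟨i, hi, hlt⟩ := h.or_prec ⟨j, hj⟩ ⟨⟨p, hpn⟩, hmem⟩
    refine ⟨i, toData_arc_fin.2 hi, ?_⟩
    simp only [hj, dif_pos, i.2]
    simpa only [hc] using hlt

theorem feasible_of_toData (hI : ∀ j, I.proc j = 1) {s : ℕ → ℕ} {mc : ℕ → ℕ}
    (h : I.toData.Feas (fun j => (s j : ℝ)) mc) :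
    Schedule.Feasible (I := I) ⟨fun j => (s j : ℝ), fun j => ⟨mc j, h.lt j j.2⟩⟩ := by
  refine ⟨fun i j hne hm => ?_, fun j => ?_, fun j ⟨p, hp⟩ => ?_⟩
  · simpa [Schedule.completion, hI] using
      h.disjoint i i.2 j j.2 (fun he => hne (Fin.ext he)) (congrArg Fin.val hm)
  · have := h.release j j.2
    rwa [toData_rel] at this
  · obtain ⟨i, hi, hlt⟩ := h.or_prec j j.2 ⟨p, toData_arc_fin.2 hp⟩
    have hin := (toData_valid i j hi).1
    exact ⟨⟨i, hin⟩, toData_arc_fin.1 hi, by simpa [Schedule.completion, hI] using hlt⟩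

theorem optimal_of_toData (hI : ∀ j, I.proc j = 1) {s : ℕ → ℕ} {mc : ℕ → ℕ}
    (h : I.toData.Feas (fun j => (s j : ℝ)) mc)
    (hopt : ∀ st mc', I.toData.Feas st mc' → ∀ c : ℝ, (∀ j < I.n, st j + 1 ≤ c) →
      ∀ j < I.n, (s j : ℝ) + 1 ≤ c) :
    Schedule.Optimal (I := I) ⟨fun j => (s j : ℝ), fun j => ⟨mc j, h.lt j j.2⟩⟩ := by
  refine ⟨feasible_of_toData hI h, fun S' hS' => ?_⟩
  rcases isEmpty_or_nonempty (Fin I.n) with he | he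
  · simp [Schedule.makespan]
  · refine ciSup_le fun j => ?_
    have := hopt _ _ (hS'.toData hI) S'.makespan (fun i hi => ?_) j j.2
    · simpa [Schedule.completion, hI] using this
    · simp only [hi, dif_pos]
      have h1 : S'.completion ⟨i, hi⟩ ≤ S'.makespan :=
        le_ciSup (f := S'.completion) (Set.finite_range _).bddAbove _
      simpa [Schedule.completion, hI] using h1

end Instance

theorem length_le_bitSize (l : List ℕ) : l.length ≤ bitSize l := by
  induction l with
  | nil => simp [bitSize]
  | cons x l ih =>
    have := len_pos x
    simp only [bitSize, List.map_cons, List.sum_cons, List.length_cons] at ih ⊢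
    omega

theorem bounded_init (l : List ℕ) : (State.init l).Bounded (bitSize l + 1) := by
  have h0 : len 0 ≤ bitSize l + 1 := by simp [len]
  refine ⟨fun r => ?_, fun k a => ?_⟩
  · simp only [State.init]
    split_ifs
    · have := Nat.size_le.2 (Nat.lt_two_pow_self (n := l.length))
      have := length_le_bitSize l
      simp only [len]
      omega
    · exact h0
  · simp only [State.init]
    split_ifs
    · by_cases ha : a < l.length
      · rw [List.getD_eq_getElem _ _ ha]
        have : len l[a] ≤ bitSize l :=
          List.single_le_sum (by simp) _ (List.mem_map_of_mem (List.getElem_mem ha))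
        omega
      · rw [List.getD_eq_default _ _ (by omega)]
        exact h0
    · exact h0

end OrSched

open RAM OrSched in
theorem corollary3 :
    RAM.PolyTimeSolvable {I : OrSched.Instance | ∀ j, I.proc j = 1}
      OrSched.Instance.encode OrSched.Instance.IsSolution := by
  let c₁ : Cmd := .set 1 (.cell 0 0)
  let c₂ : Cmd := .set 2 (.cell 0 2)
  let K : Polynomial ℕ := Polynomial.C (((Ex.cell 0 0).steps + (len 0 + 1)) +
    ((Ex.cell 0 2).steps + (len 0 + 1))) + Program.main.steps
  refine ⟨.seq (c₁.comp 0) (.seq (c₂.comp 0) (Program.main.comp 0)),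
    2 * K * (Polynomial.X + 1 + K), fun I hI => ?_⟩
  set l := I.encode with hl
  obtain ⟨σ₁, h1, v1, -⟩ := Cmd.comp_set 1 (.cell 0 0) 0 (State.init l)
  obtain ⟨σ₂, h2, v2, -⟩ := Cmd.comp_set 2 (.cell 0 2) 0 σ₁
  have hv : σ₂.view = ((State.init l).view.setReg 1 I.n).setReg 2 I.arcs.length := by
    rw [v2, v1]
    rfl
  have hlen := I.length_encode
  rw [← hl] at hlen
  have hbit := length_le_bitSize l
  obtain ⟨σ₃, h3, v3, -⟩ := Program.main.comp_spec [1, 2] (bitSize l) (by decide) (by decide) 0 σ₂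
    (by
      rw [hv]
      simp
      omega)
  obtain ⟨t, ht, hcost⟩ := h1.seq (h2.seq h3)
  refine ⟨σ₃, t, ht, ?_, ?_⟩
  · refine ((hcost _ (bounded_init l)).2).trans (le_of_eq ?_)
    simp only [K, Polynomial.eval_mul, Polynomial.eval_add, Polynomial.eval_X, Polynomial.eval_one,
      Polynomial.eval_C, Polynomial.eval_ofNat, add_assoc]
  · have hmem : σ₂.view.mem = (State.init l).mem := by rw [hv]; rfl
    have hR : Program.Reads I.toData (σ₂.view.setReg 3 (σ₂.view.mem 0 1)) := by
      rw [hv]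
      exact ⟨rfl, rfl, rfl, fun _ => rfl, fun _ => rfl, fun _ => rfl⟩
    have hout : σ₃.out = (Program.main.run σ₂.view).out := by rw [← v3]; rfl
    rw [hout]
    rcases Program.main_spec Instance.toData_valid hR
      (fun k hk j => by rw [hmem]; simp [State.init, hk])
      (by rw [hv]; rfl) (by rw [hv]; rfl) (by rw [hv]; rfl) with
      ⟨ho, hno⟩ | ⟨s, mc, ho, hF, hopt⟩
    · exact .inr ⟨fun ⟨S, hS⟩ => hno _ _ (hS.toData hI), ho⟩
    · refine .inl ⟨fun j => s j, fun j => ⟨mc j, hF.lt j j.2⟩, ?_,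
        Instance.optimal_of_toData hI hF hopt⟩
      have hmap : ∀ g : ℕ → ℕ, (List.range I.n).map g = List.ofFn fun j : Fin I.n => g j := by
        intro g
        rw [List.ofFn_eq_map, ← List.map_coe_finRange_eq_range, List.map_map]
        rfl
      rw [ho, ← hmap s, ← hmap mc]
      rfl
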